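/- Let $M$ be a closed (compact, boundaryless, Hausdorff) smooth $n$-manifold, $g$ a smooth Riemannian metric on $M$ and $\alpha$ a smooth $1$-form on $M$. Let $$G=\mathrm{Mag}_{\mathrm{ex}}(M,g,\alpha)=\{\psi\in\mathrm{Diff}(M)\mid \psi^*g=g,\ \psi^*\alpha=\alpha\},$$ and let $\mathfrak g=\mathrm{Lie}(G)$ be its Lie algebra, realized as the space of vector fields on $M$ that are the velocities $\frac{d}{dt}\big|_{t=0}c_t$ of smooth curves $t\mapsto c_t\in G$ with $c_0=\mathrm{id}$; the adjoint action is the push-forward of vector fields, $\mathrm{Ad}_\psi X=d\psi\circ X\circ\psi^{-1}$. Let $G$ act on $TM$ by $\psi\cdot(q,v)=(\psi(q),d\psi_q v)$, let $\pi\colon TM\to M$ be the projection, let $\lambda_{(q,v)}(\xi)=g_q(v,d\pi\,\xi)$, and let $$\omega=d\lambda-\pi^*d\alpha .$$ Then $\omega$ is a symplectic form on $TM$, and the action of $G$ on $(TM,\omega)$ is Hamiltonian with equivariant moment map $$\mu\colon TM\to\mathfrak g^*,\qquad \mu(q,v)(X)=g_q(v,X_q)-\alpha_q(X_q).$$ That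 is: every $\psi\in G$ acts on $TM$ by a smooth map preserving $\omega$; for every $X\in\mathfrak g$ the function $\langle\mu,X\rangle$ is smooth, and the infinitesimal generator $X^\#$ of $X$ on $TM$, i.e. $X^\#(p)=\frac{d}{dt}\big|_{t=0}c_t\cdot p$ for every smooth curve $c$ in $G$ with $c_0=\mathrm{id}$ and velocity $X$ (independently of $c$), satisfies $\iota_{X^\#}\omega=-d\langle\mu,X\rangle$; and $\mu(\psi\cdot p)(X)=\mu(p)(\mathrm{Ad}_{\psi^{-1}}X)$ for all $\psi\in G$, $p\in TM$, $X\in\mathfrak g$. -/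

import Mathlib

open scoped Manifold ContDiff

noncomputable section

namespace Magnetic

section Diffeomorphisms

variable {E : Type*} [NormedAddCommGroup E] [NormedSpace ℝ E]
  {H : Type*} [TopologicalSpace H] (I : ModelWithCorners ℝ E H)
  (M : Type*) [TopologicalSpace M] [ChartedSpace H M]

/-- The smooth diffeomorphisms of `M`. -/
abbrev Diff := M ≃ₘ^∞⟮I, I⟯ M

/-- `Diff(M)` is a group under composition. -/
instance : Group (Diff I M) where
  mul φ ψ := ψ.trans φ
  one := Diffeomorph.refl I M ∞
  inv φ := φ.symm
  mul_assoc _ _ _ := rfl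
  one_mul _ := rfl
  mul_one _ := rfl
  inv_mul_cancel φ := φ.self_trans_symm

variable {I M}

theorem mul_apply (φ ψ : Diff I M) (q : M) : (φ * ψ) q = φ (ψ q) := rfl

theorem one_apply (q : M) : (1 : Diff I M) q = q := rfl

theorem apply_inv (φ : Diff I M) (q : M) : φ (φ⁻¹ q) = q := φ.apply_symm_apply q

theorem inv_apply (φ : Diff I M) (q : M) : φ⁻¹ (φ q) = q := φ.symm_apply_apply q

theorem mdiffAt (φ : Diff I M) (q : M) : MDifferentiableAt I I φ q :=
  φ.mdifferentiable (by simp) q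

/-- The natural lifted action of diffeomorphisms of `M` on the tangent bundle,
`ψ • (q, v) = (ψ q, dψ_q v)`. -/
instance [IsManifold I 1 M] : MulAction (Diff I M) (TangentBundle I M) where
  smul ψ p := tangentMap I I ψ p
  one_smul p := congrFun (tangentMap_id (I := I) (M := M)) p
  mul_smul φ ψ p := tangentMap_comp_at p (mdiffAt φ _) (mdiffAt ψ _)

theorem smul_def [IsManifold I 1 M] (ψ : Diff I M) (p : TangentBundle I M) :
    ψ • p = tangentMap I I ψ p := rfl

end Diffeomorphisms

section Forms

variable {E : Type*} [NormedAddCommGroup E] [NormedSpace ℝ E]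
  {H : Type*} [TopologicalSpace H] (I : ModelWithCorners ℝ E H)
  (M : Type*) [TopologicalSpace M] [ChartedSpace H M]

/-- (Not necessarily smooth) differential `k`-forms on `M`. -/
abbrev Form (k : ℕ) := ∀ p : M, (TangentSpace I p) [⋀^Fin k]→L[ℝ] ℝ

variable {I M} {k : ℕ}

/-- The expression of a form in the preferred chart at `p`, i.e. its pull-back by the inverse
of this chart. It is meaningful on the target of the chart (`M` is without boundary in all
uses below). -/
def Form.inChart (σ : Form I M k) (p : M) (y : E) : E [⋀^Fin k]→L[ℝ] ℝ :=
  (σ ((extChartAt I p).symm y)).compContinuousLinearMap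
    (mfderiv 𝓘(ℝ, E) I (extChartAt I p).symm y :
      E →L[ℝ] TangentSpace I ((extChartAt I p).symm y))

/-- A form is smooth if all its chart expressions are. -/
def Form.IsSmooth (σ : Form I M k) : Prop :=
  ∀ p : M, ContDiffOn ℝ ∞ (σ.inChart p) (extChartAt I p).target

/-- The exterior derivative of a form on a manifold, computed at `p` in the preferred
chart at `p`. -/
def Form.d (σ : Form I M k) : Form I M (k + 1) := fun p =>
  (extDeriv (σ.inChart p) (extChartAt I p p)).compContinuousLinearMap
    (mfderiv I 𝓘(ℝ, E) (extChartAt I p) p : TangentSpace I p →L[ℝ] E)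

/-- The pull-back of a form by a map. -/
def Form.pullback {E' : Type*} [NormedAddCommGroup E'] [NormedSpace ℝ E']
    {H' : Type*} [TopologicalSpace H'] {I' : ModelWithCorners ℝ E' H'}
    {N : Type*} [TopologicalSpace N] [ChartedSpace H' N]
    (f : N → M) (σ : Form I M k) : Form I' N k := fun p =>
  (σ (f p)).compContinuousLinearMap (mfderiv I' I f p)

/-- Symplectic forms: smooth, closed and nondegenerate two-forms. -/
structure Form.IsSymplectic (σ : Form I M 2) : Prop where
  smooth : σ.IsSmooth
  closed : σ.d = 0
  nondegenerate : ∀ (p : M) (u : TangentSpace I p), (∀ w : TangentSpace I p, σ p ![u, w] = 0) →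
    u = 0

end Forms

section LieAlgebra

variable {E : Type*} [NormedAddCommGroup E] [NormedSpace ℝ E]
  {H : Type*} [TopologicalSpace H] {I : ModelWithCorners ℝ E H}
  {M : Type*} [TopologicalSpace M] [ChartedSpace H M]

variable (I) in
/-- The velocity `γ'(0)` of a curve, as an element of the tangent bundle. -/
def velocity (γ : ℝ → M) : TangentBundle I M := tangentMap 𝓘(ℝ, ℝ) I γ ⟨0, (1 : ℝ)⟩

/-- `c` is a smooth curve in the group `G` of diffeomorphisms, with `c 0 = 1`, whose velocity
at time `0` is the vector field `X`. -/
structure IsCurveWithVelocity (G : Subgroup (Diff I M)) (c : ℝ → G)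
    (X : ∀ q : M, TangentSpace I q) : Prop where
  smooth : ContMDiff (𝓘(ℝ, ℝ).prod I) I ∞ (fun x : ℝ × M => (c x.1 : Diff I M) x.2)
  zero : c 0 = 1
  velocity_eq : ∀ q : M, velocity I (fun t => (c t : Diff I M) q) = ⟨q, X q⟩

theorem IsCurveWithVelocity.mdifferentiableAt {G : Subgroup (Diff I M)} {c : ℝ → G}
    {X : ∀ q : M, TangentSpace I q} (h : IsCurveWithVelocity G c X) (q : M) :
    MDifferentiableAt 𝓘(ℝ, ℝ) I (fun t => (c t : Diff I M) q) 0 := by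
  have h1 : ContMDiff 𝓘(ℝ, ℝ) (𝓘(ℝ, ℝ).prod I) ∞ (fun t : ℝ => (t, q)) :=
    contMDiff_id.prodMk contMDiff_const
  exact (h.smooth.comp h1).mdifferentiableAt (by simp)

theorem velocity_comp {E' : Type*} [NormedAddCommGroup E'] [NormedSpace ℝ E']
    {H' : Type*} [TopologicalSpace H'] {I' : ModelWithCorners ℝ E' H'}
    {N : Type*} [TopologicalSpace N] [ChartedSpace H' N] [IsManifold I 1 M] [IsManifold I' 1 N]
    {f : M → N} {γ : ℝ → M}
    (hf : MDifferentiableAt I I' f (γ 0)) (hγ : MDifferentiableAt 𝓘(ℝ, ℝ) I γ 0) :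
    velocity I' (fun t => f (γ t)) = tangentMap I I' f (velocity I γ) :=
  tangentMap_comp_at (I := 𝓘(ℝ, ℝ)) (I' := I) (I'' := I') (f := γ) (g := f) ⟨0, (1 : ℝ)⟩ hf hγ

theorem velocity_eq_iff {γ : ℝ → M} {q : M} {v : TangentSpace I q} :
    velocity I γ = ⟨q, v⟩ ↔
      γ 0 = q ∧ (mfderiv 𝓘(ℝ, ℝ) I γ 0 (1 : ℝ) : E) = (v : E) := by
  constructor
  · intro h
    have h1 : γ 0 = q := congrArg Bundle.TotalSpace.proj h
    have h2 := (Bundle.TotalSpace.mk.injEq _ _ _ _).mp h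
    exact ⟨h1, eq_of_heq h2.2⟩
  · rintro ⟨h1, h2⟩
    subst h1
    exact congrArg (Bundle.TotalSpace.mk (γ 0)) h2

theorem IsCurveWithVelocity.const (G : Subgroup (Diff I M)) :
    IsCurveWithVelocity G (fun _ => 1) (fun _ => 0) where
  smooth := contMDiff_snd
  zero := rfl
  velocity_eq q := by
    rw [velocity_eq_iff]
    refine ⟨rfl, ?_⟩
    have : mfderiv 𝓘(ℝ, ℝ) I (fun _ : ℝ => q) 0 = 0 := mfderiv_const
    exact congrArg (fun L : ℝ →L[ℝ] E => L 1) this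

theorem IsCurveWithVelocity.smul [IsManifold I 1 M] {G : Subgroup (Diff I M)} {c : ℝ → G}
    {X : ∀ q : M, TangentSpace I q} (h : IsCurveWithVelocity G c X) (a : ℝ) :
    IsCurveWithVelocity G (fun t => c (a * t)) (a • X) where
  smooth := by
    have h1 : ContMDiff (𝓘(ℝ, ℝ).prod I) (𝓘(ℝ, ℝ).prod I) ∞
        (fun x : ℝ × M => (a * x.1, x.2)) :=
      ((contDiff_const.mul contDiff_id).contMDiff.comp contMDiff_fst).prodMk contMDiff_snd
    exact h.smooth.comp h1
  zero := by simpa using h.zero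
  velocity_eq q := by
    obtain ⟨h1, h2⟩ := velocity_eq_iff.mp (h.velocity_eq q)
    rw [velocity_eq_iff]
    refine ⟨by simpa using h1, ?_⟩
    have h3 : HasMFDerivAt 𝓘(ℝ, ℝ) 𝓘(ℝ, ℝ) (fun t : ℝ => a * t) 0
        (ContinuousLinearMap.toSpanSingleton ℝ a) := by
      have : HasDerivAt (fun t : ℝ => a * t) a 0 := by
        simpa using (hasDerivAt_id (0 : ℝ)).const_mul a
      exact this.hasFDerivAt.hasMFDerivAt
    have h4 : HasMFDerivAt 𝓘(ℝ, ℝ) I (fun t => (c t : Diff I M) q) (a * 0)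
        (mfderiv 𝓘(ℝ, ℝ) I (fun t => (c t : Diff I M) q) (a * 0)) := by
      have := (h.mdifferentiableAt q).hasMFDerivAt
      rw [mul_zero]
      exact this
    have h5 := (h4.comp 0 h3).mfderiv
    have h6 : (mfderiv 𝓘(ℝ, ℝ) I (fun t => (c (a * t) : Diff I M) q) 0 : ℝ →L[ℝ] E) 1 =
        (mfderiv 𝓘(ℝ, ℝ) I (fun t => (c t : Diff I M) q) (a * 0) : ℝ →L[ℝ] E) ((1 : ℝ) • a) :=
      congrArg (fun L : ℝ →L[ℝ] E => L 1) h5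
    rw [mul_zero, one_smul] at h6
    refine h6.trans ?_
    have lin : ∀ L : ℝ →L[ℝ] E, L a = a • L 1 := fun L => by simpa using L.map_smul a 1
    have h7 := lin (mfderiv 𝓘(ℝ, ℝ) I (fun t => (c t : Diff I M) q) 0)
    refine h7.trans ?_
    exact congrArg (fun v : E => a • v) h2

theorem IsCurveWithVelocity.mul [IsManifold I 1 M] {G : Subgroup (Diff I M)} {c d : ℝ → G}
    {X Y : ∀ q : M, TangentSpace I q} (hc : IsCurveWithVelocity G c X)
    (hd : IsCurveWithVelocity G d Y) :
    IsCurveWithVelocity G (fun t => c t * d t) (X + Y) where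
  smooth := hc.smooth.comp (contMDiff_fst.prodMk hd.smooth)
  zero := by simp [hc.zero, hd.zero]
  velocity_eq q := by
    obtain ⟨hc1, hc2⟩ := velocity_eq_iff.mp (hc.velocity_eq q)
    obtain ⟨hd1, hd2⟩ := velocity_eq_iff.mp (hd.velocity_eq q)
    have hd0 : ((d 0 : G) : Diff I M) q = q := hd1
    have hF : MDifferentiableAt (𝓘(ℝ, ℝ).prod I) I
        (fun x : ℝ × M => (c x.1 : Diff I M) x.2) (0, q) :=
      hc.smooth.mdifferentiableAt (by simp)
    have hγ : MDifferentiableAt 𝓘(ℝ, ℝ) (𝓘(ℝ, ℝ).prod I) (fun t : ℝ => (t, (d t : Diff I M) q)) 0 :=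
      mdifferentiableAt_id.prodMk (hd.mdifferentiableAt q)
    have hv : velocity (𝓘(ℝ, ℝ).prod I) (fun t : ℝ => (t, (d t : Diff I M) q)) =
        ⟨(0, q), ((1 : ℝ), Y q)⟩ := by
      refine velocity_eq_iff.mpr ⟨by rw [hd0], ?_⟩
      have h1 := (hasMFDerivAt_id (I := 𝓘(ℝ, ℝ)) (0 : ℝ)).prodMk (hd.mdifferentiableAt q).hasMFDerivAt
      have h2 := congrArg (fun L : ℝ →L[ℝ] ℝ × E => L 1) h1.mfderiv
      exact h2.trans (Prod.ext rfl hd2)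
    have h1 := velocity_comp (I' := I) (f := fun x : ℝ × M => (c x.1 : Diff I M) x.2)
      (γ := fun t : ℝ => (t, (d t : Diff I M) q)) (by rw [hd0]; exact hF) hγ
    rw [hv] at h1
    refine h1.trans ?_
    refine Eq.trans (b := (⟨(c 0 : Diff I M) q, mfderiv (𝓘(ℝ, ℝ).prod I) I
      (fun x : ℝ × M => (c x.1 : Diff I M) x.2) (0, q) ((1 : ℝ), Y q)⟩ : TangentBundle I M)) rfl ?_
    let y : E := Y q
    let w : TangentSpace (𝓘(ℝ, ℝ).prod I) ((0, q) : ℝ × M) := ((1 : ℝ), y)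
    have hadd := mfderiv_prod_eq_add_apply (v := w) hF
    have hid : (mfderiv I I (fun x : M => (c 0 : Diff I M) x) q : E →L[ℝ] E) =
        ContinuousLinearMap.id ℝ E := by
      have : (fun x : M => (c 0 : Diff I M) x) = id := by
        funext x
        rw [hc.zero]
        rfl
      rw [this]
      exact mfderiv_id
    have hsum : (mfderiv 𝓘(ℝ, ℝ) I (fun t => (c t : Diff I M) q) 0 (1 : ℝ) : E) +
        (mfderiv I I (fun x : M => (c 0 : Diff I M) x) q : E →L[ℝ] E) (Y q) =
        ((X q : E) + (Y q : E) : E) := by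
      rw [hid]
      exact congrArg (fun v : E => v + y) hc2
    have hq : (c 0 : Diff I M) q = q := hc1
    have gen : ∀ (q' : M) (u : E) (u' : E), q' = q → u = u' →
        ((⟨q', u⟩ : TangentBundle I M) = ⟨q, u'⟩) := by
      rintro q' u u' rfl rfl
      rfl
    exact gen _ _ _ hq (hadd.trans hsum)

/-- Conjugating a curve by a group element pushes its velocity forward. -/
theorem IsCurveWithVelocity.conj [IsManifold I 1 M] {G : Subgroup (Diff I M)} {c : ℝ → G}
    {X : ∀ q : M, TangentSpace I q} (hc : IsCurveWithVelocity G c X) (ψ : G) :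
    IsCurveWithVelocity G (fun t => ψ * c t * ψ⁻¹)
      (VectorField.mpullback I I ((ψ⁻¹ : G) : Diff I M) X) where
  smooth := by
    have h1 := (ψ : Diff I M).contMDiff.comp (hc.smooth.comp
      (contMDiff_fst.prodMk ((ψ : Diff I M)⁻¹.contMDiff.comp contMDiff_snd)))
    exact h1
  zero := by simp [hc.zero]
  velocity_eq q := by
    have h1 := velocity_comp (I' := I) (f := fun x : M => (ψ : Diff I M) x)
      (γ := fun t : ℝ => (c t : Diff I M) ((ψ : Diff I M)⁻¹ q))
      (mdiffAt _ _) (hc.mdifferentiableAt _)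
    rw [hc.velocity_eq] at h1
    refine h1.trans ?_
    have gen : ∀ (q' : M) (u : E) (u' : E), q' = q → u = u' →
        ((⟨q', u⟩ : TangentBundle I M) = ⟨q, u'⟩) := by
      rintro q' u u' rfl rfl
      rfl
    refine gen _ _ _ (apply_inv (ψ : Diff I M) q) ?_
    have hA : ∀ q, (mfderiv I I (ψ : Diff I M) ((ψ : Diff I M)⁻¹ q) : E →L[ℝ] E).comp
        (mfderiv I I ((ψ : Diff I M)⁻¹ : Diff I M) q : E →L[ℝ] E) =
        ContinuousLinearMap.id ℝ E := fun q => by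
      have e1 := mfderiv_comp q (mdiffAt (ψ : Diff I M) _) (mdiffAt (ψ : Diff I M)⁻¹ q)
      have e2 : ((ψ : Diff I M) : M → M) ∘ ((ψ : Diff I M)⁻¹ : Diff I M) = id := by
        funext x
        exact apply_inv _ x
      rw [e2] at e1
      exact e1.symm.trans mfderiv_id
    have hB : (mfderiv I I ((ψ : Diff I M)⁻¹ : Diff I M) q : E →L[ℝ] E).comp
        (mfderiv I I (ψ : Diff I M) ((ψ : Diff I M)⁻¹ q) : E →L[ℝ] E) =
        ContinuousLinearMap.id ℝ E := by
      have e1 := mfderiv_comp ((ψ : Diff I M)⁻¹ q) (mdiffAt (ψ : Diff I M)⁻¹ _)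
        (mdiffAt (ψ : Diff I M) _)
      have e2 : (((ψ : Diff I M)⁻¹ : Diff I M) : M → M) ∘ ((ψ : Diff I M) : M → M) = id := by
        funext x
        exact inv_apply _ x
      rw [e2, apply_inv] at e1
      exact e1.symm.trans mfderiv_id
    have := ContinuousLinearMap.inverse_eq hB (hA q)
    exact (congrArg (fun L : E →L[ℝ] E => L (X ((ψ : Diff I M)⁻¹ q))) this).symm

/-- The Lie algebra `T_1 G` of a group `G` of diffeomorphisms of `M`, realized by vector fields
on `M`: the velocities at time `0` of the smooth curves in `G` through the identity. -/
def lieAlgebra [IsManifold I 1 M] (G : Subgroup (Diff I M)) :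
    Submodule ℝ (∀ q : M, TangentSpace I q) where
  carrier := {X | ∃ c : ℝ → G, IsCurveWithVelocity G c X}
  add_mem' := by
    rintro X Y ⟨c, hc⟩ ⟨d, hd⟩
    exact ⟨_, hc.mul hd⟩
  zero_mem' := ⟨_, .const G⟩
  smul_mem' := by
    rintro a X ⟨c, hc⟩
    exact ⟨_, hc.smul a⟩

/-- The adjoint action of `ψ ∈ G` on the Lie algebra: push-forward of vector fields by `ψ`,
i.e. pull-back by `ψ⁻¹`. -/
def Ad [IsManifold I 1 M] (G : Subgroup (Diff I M)) (ψ : G) (X : lieAlgebra G) : lieAlgebra G :=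
  ⟨VectorField.mpullback I I ((ψ⁻¹ : G) : Diff I M) X.1, by
    obtain ⟨c, hc⟩ := X.2
    exact ⟨_, hc.conj ψ⟩⟩

end LieAlgebra

section Hamiltonian

variable {E : Type*} [NormedAddCommGroup E] [NormedSpace ℝ E]
  {H : Type*} [TopologicalSpace H] {I : ModelWithCorners ℝ E H}
  {M : Type*} [TopologicalSpace M] [ChartedSpace H M] [IsManifold I 1 M]
  {F : Type*} [NormedAddCommGroup F] [NormedSpace ℝ F]
  {K : Type*} [TopologicalSpace K] {J : ModelWithCorners ℝ F K}
  {N : Type*} [TopologicalSpace N] [ChartedSpace K N]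

variable (J) in
/-- `ξ` is the infinitesimal generator on `N` of `X ∈ Lie(G)`: for every smooth curve `c` in `G`
with `c 0 = 1` and velocity `X` (for instance a one-parameter group generated by `X`),
the derivative of `t ↦ c t • p` at `t = 0` is `ξ p`. -/
def IsInfinitesimalGenerator (G : Subgroup (Diff I M)) [MulAction G N]
    (X : lieAlgebra G) (ξ : ∀ p : N, TangentSpace J p) : Prop :=
  ∀ c : ℝ → G, IsCurveWithVelocity G c X.1 →
    ∀ p : N, MDifferentiableAt 𝓘(ℝ, ℝ) J (fun t => c t • p) 0 ∧
      velocity J (fun t => c t • p) = ⟨p, ξ p⟩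

/-- The action of a group `G` of diffeomorphisms of `M` on the symplectic manifold `(N, σ)`
is Hamiltonian, with equivariant moment map `μ : N → Lie(G)^*`. -/
structure IsHamiltonianAction (G : Subgroup (Diff I M)) [MulAction G N]
    (σ : Form J N 2) (μ : N → Module.Dual ℝ (lieAlgebra G)) : Prop where
  /-- `(N, σ)` is a symplectic manifold -/
  symplectic : σ.IsSymplectic
  /-- each element of `G` acts smoothly -/
  smooth_smul : ∀ ψ : G, ContMDiff J J ∞ (fun p : N => ψ • p)
  /-- each element of `G` acts symplectically -/
  preserves : ∀ ψ : G, σ.pullback (fun p : N => ψ • p) = σ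
  /-- the components of the moment map are smooth functions -/
  smooth_moment : ∀ X : lieAlgebra G, ContMDiff J 𝓘(ℝ, ℝ) ∞ (fun p => μ p X)
  /-- the generator `ξ` of `X` satisfies `ι_ξ σ = - d⟨μ, X⟩` -/
  hamiltonian : ∀ X : lieAlgebra G, ∃ ξ : ∀ p : N, TangentSpace J p,
    IsInfinitesimalGenerator J G X ξ ∧
      ∀ (p : N) (w : TangentSpace J p),
        σ p ![ξ p, w] = - (mfderiv J 𝓘(ℝ, ℝ) (fun p' => μ p' X) p w : ℝ)
  /-- `μ` intertwines the action on `N` with the coadjoint action -/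
  equivariant : ∀ (ψ : G) (p : N) (X : lieAlgebra G), μ (ψ • p) X = μ p (Ad G ψ⁻¹ X)

end Hamiltonian

section MagneticSystems

variable {E : Type*} [NormedAddCommGroup E] [NormedSpace ℝ E]
  {H : Type*} [TopologicalSpace H] {I : ModelWithCorners ℝ E H}
  {M : Type*} [TopologicalSpace M] [ChartedSpace H M] [IsManifold I ∞ M]

variable (I M) in
/-- Smooth Riemannian metrics on `M`. -/
abbrev Metric := Bundle.ContMDiffRiemannianMetric I ∞ E (fun q : M => TangentSpace I q)

/-- The exact magnetomorphism group `Mag_ex(M, g, α)`. -/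
def magEx (g : Metric I M) (α : Form I M 1) : Subgroup (Diff I M) where
  carrier := {ψ | (∀ (q : M) (v w : TangentSpace I q),
      g.inner (ψ q) (mfderiv I I ψ q v) (mfderiv I I ψ q w) = g.inner q v w) ∧
    α.pullback ψ = α}
  mul_mem' := by
    rintro φ ψ ⟨hφ, hφ'⟩ ⟨hψ, hψ'⟩
    have key : ∀ q, mfderiv I I (φ * ψ : Diff I M) q =
        (mfderiv I I φ (ψ q)).comp (mfderiv I I ψ q) := fun q =>
      mfderiv_comp q (mdiffAt φ _) (mdiffAt ψ _)
    refine ⟨fun q v w => ?_, ?_⟩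
    · rw [key]
      exact (hφ _ _ _).trans (hψ _ _ _)
    · funext q
      ext v
      have h1 := congrFun hφ' (ψ q)
      have h2 := congrFun hψ' q
      rw [← h2, Form.pullback, Form.pullback, ← h1, Form.pullback, key]
      rfl
  one_mem' := by
    have key : ∀ q, mfderiv I I (1 : Diff I M) q = ContinuousLinearMap.id ℝ _ := fun q =>
      mfderiv_id
    refine ⟨fun q v w => ?_, ?_⟩
    · rw [key]
      rfl
    · funext q
      ext v
      rw [Form.pullback, key]
      rfl
  inv_mem' := by
    rintro ψ ⟨hψ, hψ'⟩
    have key : ∀ (q : M) (v : TangentSpace I q),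
        (mfderiv I I ψ (ψ⁻¹ q) (mfderiv I I (ψ⁻¹ : Diff I M) q v) : E) = (v : E) := fun q v => by
      have e1 := mfderiv_comp q (mdiffAt ψ _) (mdiffAt ψ⁻¹ q)
      have e2 : (ψ : M → M) ∘ (ψ⁻¹ : Diff I M) = id := by
        funext x
        exact apply_inv ψ x
      rw [e2] at e1
      exact congrArg (fun L : E →L[ℝ] E => L v) (e1.symm.trans mfderiv_id)
    refine ⟨fun q v w => ?_, ?_⟩
    · rw [← hψ]
      have gen : ∀ (q' : M) (u u' v v' : E), q' = q → u = u' → v = v' →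
          g.inner q' u v = g.inner q u' v' := by
        rintro q' u u' v v' rfl rfl rfl
        rfl
      exact gen _ _ _ _ _ (apply_inv ψ q) (key q v) (key q w)
    · funext q
      ext v
      have h1 : α.pullback (ψ⁻¹ : Diff I M) q v = (α (ψ⁻¹ q))
          (fun i => mfderiv I I (ψ⁻¹ : Diff I M) q (v i)) := rfl
      rw [h1, ← congrFun hψ' (ψ⁻¹ q)]
      have gen : ∀ (q' : M) (u u' : Fin 1 → E), q' = q → u = u' → α q' u = α q u' := by
        rintro q' u u' rfl rfl
        rfl
      exact gen _ _ _ (apply_inv ψ q) (funext fun i => key q (v i))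

/-- The canonical one-form on the tangent bundle, `λ_{(q,v)}(ξ) = g_q(v, dπ ξ)`. -/
def liouville (g : Metric I M) : Form I.tangent (TangentBundle I M) 1 := fun p =>
  ContinuousAlternatingMap.ofSubsingleton ℝ _ ℝ (0 : Fin 1)
    ((g.inner p.1 p.2).comp
      (mfderiv I.tangent I (Bundle.TotalSpace.proj : TangentBundle I M → M) p))

/-- The twisted form `dλ - π^* dα` on the tangent bundle. -/
def twistedForm (g : Metric I M) (α : Form I M 1) : Form I.tangent (TangentBundle I M) 2 :=
  (liouville g).d - (α.d).pullback (Bundle.TotalSpace.proj : TangentBundle I M → M)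

/-- The map `μ(q, v)(X) = g_q(v, X_q) - α_q(X_q)`. -/
def momentMap (g : Metric I M) (α : Form I M 1) (p : TangentBundle I M) :
    Module.Dual ℝ (lieAlgebra (magEx g α)) where
  toFun X := g.inner p.1 p.2 (X.1 p.1) - α p.1 ![X.1 p.1]
  map_add' X Y := by
    have h1 : g.inner p.1 p.2 ((X + Y).1 p.1) =
        g.inner p.1 p.2 (X.1 p.1) + g.inner p.1 p.2 (Y.1 p.1) := map_add _ _ _
    have h2 : α p.1 ![(X + Y).1 p.1] = α p.1 ![X.1 p.1] + α p.1 ![Y.1 p.1] :=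
      (α p.1).cons_add ![] _ _
    rw [h1, h2]
    ring
  map_smul' a X := by
    have h1 : g.inner p.1 p.2 ((a • X).1 p.1) = a • g.inner p.1 p.2 (X.1 p.1) := map_smul _ _ _
    have h2 : α p.1 ![(a • X).1 p.1] = a • α p.1 ![X.1 p.1] :=
      (α p.1).toMultilinearMap.cons_smul ![] _ _
    rw [h1, h2, RingHom.id_apply, smul_sub]

end MagneticSystems

end Magnetic

end

/-! The form `ω` is exact with an invariant primitive: `ω = dβ` for `β = λ - π^*α`
(`d_twistedPotential`). The projection intertwines the lifted action with the action on `M`, and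
elements of `G` preserve `g` and `α`, so they preserve `β` (`twistedPotential_pullback_smul`), hence
also `dβ`.

If `c` is a curve in `G` with velocity `X`, and `ξ` is the velocity of the lifted curve, then `dπ ξ
= X`, so `⟨μ, X⟩ = β(ξ)` (`momentMap_eq_twistedPotential`). Formally Cartan's formula gives `ι_ξ dβ
= L_ξ β - d(β(ξ)) = -d⟨μ, X⟩`. Since `c` need not be a one-parameter group, `d_flow_moment` replaces
the Lie derivative by a computation on `ℝ × E`. Pull `β` back along `K(t, y) = Φ(t, χ⁻¹ y)`, where
`Φ` is the family of maps and `χ` a chart, and evaluate the exterior derivative on `(∂_t, w)`. The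
term `∂_t (K^*β)(w)` vanishes by invariance, and `∂_w (K^*β)(∂_t)` is the derivative of `β(ξ)` at `t
= 0`. Naturality of `d` (`extDeriv_flatPullback`) carries the identity back to the manifold.

In tangent coordinates `λ_{(x,v)}(u) = g_x(v, u₁)`, so `ω` pairs a vector with a vertical one
through the metric alone. This gives nondegeneracy, which in turn shows that the generator does not
depend on `c`: two candidates have the same contraction with `ω`. Equivariance is the invariance of
`g` and `α` applied to `X` pulled back by `ψ`. -/

noncomputable section

set_option linter.unusedSectionVars false

namespace Magnetic

open Filter
open scoped Topology

/-! ### Exterior derivative on a manifold: naturality, chart independence, `d ∘ d = 0`. -/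

section ExteriorDerivative

variable {E : Type*} [NormedAddCommGroup E] [NormedSpace ℝ E]
  {H : Type*} [TopologicalSpace H] {I : ModelWithCorners ℝ E H} [I.Boundaryless]
  {M : Type*} [TopologicalSpace M] [ChartedSpace H M] [IsManifold I ∞ M] {k : ℕ}
  {V : Type*} [NormedAddCommGroup V] [NormedSpace ℝ V]

omit [IsManifold I ∞ M] in
theorem extChartAt_target_mem_nhds_of_boundaryless {p : M} {y : E}
    (hy : y ∈ (extChartAt I p).target) : (extChartAt I p).target ∈ 𝓝 y :=
  (isOpen_extChartAt_target p).mem_nhds hy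

theorem contMDiffAt_extChartAt_symm {p : M} {y : E} (hy : y ∈ (extChartAt I p).target) :
    ContMDiffAt 𝓘(ℝ, E) I ∞ (extChartAt I p).symm y :=
  (contMDiffOn_extChartAt_symm p).contMDiffAt (extChartAt_target_mem_nhds_of_boundaryless hy)

theorem mdifferentiableAt_extChartAt_symm {p : M} {y : E} (hy : y ∈ (extChartAt I p).target) :
    MDifferentiableAt 𝓘(ℝ, E) I (extChartAt I p).symm y :=
  (contMDiffAt_extChartAt_symm hy).mdifferentiableAt (by simp)

/-- The pull-back of a form by a map from a vector space, as a form on the vector space. -/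
def Form.flatPullback (σ : Form I M k) (K : V → M) (v : V) : V [⋀^Fin k]→L[ℝ] ℝ :=
  (σ (K v)).compContinuousLinearMap (mfderiv 𝓘(ℝ, V) I K v : V →L[ℝ] TangentSpace I (K v))

omit [I.Boundaryless] [IsManifold I ∞ M] in
theorem Form.flatPullback_congr (σ : Form I M k) {K L : V → M} {v : V} (h : K =ᶠ[𝓝 v] L) :
    σ.flatPullback K v = σ.flatPullback L v := by
  -- All tangent spaces are definitionally the model space, so once the base point is generalized,
  -- an equality of points can be substituted without casts. The other `gen` statements serve the
  -- same purpose.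
  have gen : ∀ (q q' : M) (A A' : V →L[ℝ] E), q = q' → A = A' →
      (σ q).compContinuousLinearMap (A : V →L[ℝ] TangentSpace I q) =
        (σ q').compContinuousLinearMap (A' : V →L[ℝ] TangentSpace I q') := by
    rintro q q' A A' rfl rfl
    rfl
  exact gen _ _ _ _ h.eq_of_nhds h.mfderiv_eq

omit [I.Boundaryless] [IsManifold I ∞ M] in
theorem Form.flatPullback_comp (σ : Form I M k) {W : Type*} [NormedAddCommGroup W]
    [NormedSpace ℝ W] {K : W → M} {f : V → W} {v : V}
    (hK : MDifferentiableAt 𝓘(ℝ, W) I K (f v)) (hf : DifferentiableAt ℝ f v) :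
    σ.flatPullback (K ∘ f) v = (σ.flatPullback K (f v)).compContinuousLinearMap (fderiv ℝ f v) := by
  have h := mfderiv_comp v hK hf.mdifferentiableAt
  rw [mfderiv_eq_fderiv] at h
  ext w
  exact congrArg (fun A : V →L[ℝ] E => σ (K (f v)) (fun i => A (w i))) h

/-- Near `v` the map `K` factors as the inverse of the chart at `p` after its own coordinate
expression. Using one fixed chart on a whole neighbourhood allows the pull-back to be differentiated
as a form between vector spaces. -/
theorem Form.flatPullback_eventuallyEq (σ : Form I M k) {K : V → M} {v : V}
    (hK : ContMDiffAt 𝓘(ℝ, V) I ∞ K v) {p : M} (hp : K v ∈ (extChartAt I p).source) :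
    σ.flatPullback K =ᶠ[𝓝 v] fun v' => (σ.inChart p (extChartAt I p (K v'))).compContinuousLinearMap
      (fderiv ℝ (extChartAt I p ∘ K) v') := by
  have h1 : ∀ᶠ v' in 𝓝 v, ContMDiffAt 𝓘(ℝ, V) I 1 K v' :=
    (contMDiffAt_iff_contMDiffAt_nhds (by simp)).mp (hK.of_le (by simp))
  have h2 : ∀ᶠ v' in 𝓝 v, K v' ∈ (extChartAt I p).source :=
    hK.continuousAt.preimage_mem_nhds ((isOpen_extChartAt_source p).mem_nhds hp)
  filter_upwards [h1, h2, h2.eventually_nhds] with v' h1 h2 h3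
  have e : K =ᶠ[𝓝 v'] (extChartAt I p).symm ∘ (extChartAt I p ∘ K) :=
    h3.mono fun z hz => ((extChartAt I p).left_inv hz).symm
  rw [σ.flatPullback_congr e, σ.flatPullback_comp]
  · rfl
  · exact mdifferentiableAt_extChartAt_symm ((extChartAt I p).map_source h2)
  · refine MDifferentiableAt.differentiableAt (MDifferentiableAt.comp v' ?_ (h1.mdifferentiableAt (by simp)))
    exact mdifferentiableAt_extChartAt (by rwa [extChartAt_source] at h2)

omit [I.Boundaryless] in
theorem contDiffAt_extChartAt_comp {K : V → M} {v : V}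
    (hK : ContMDiffAt 𝓘(ℝ, V) I ∞ K v) {p : M} (hp : K v ∈ (extChartAt I p).source) :
    ContDiffAt ℝ ∞ (extChartAt I p ∘ K) v :=
  ((contMDiffAt_extChartAt' (by rwa [extChartAt_source] at hp)).comp v hK).contDiffAt

omit [IsManifold I ∞ M] in
theorem Form.IsSmooth.contDiffAt_inChart {σ : Form I M k} (hσ : σ.IsSmooth) {p : M} {y : E}
    (hy : y ∈ (extChartAt I p).target) : ContDiffAt ℝ ∞ (σ.inChart p) y :=
  (hσ p).contDiffAt (extChartAt_target_mem_nhds_of_boundaryless hy)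

theorem minSmoothness_two_le_infty : minSmoothness ℝ 2 ≤ (∞ : WithTop ℕ∞) := by
  rw [minSmoothness_of_isRCLikeNormedField]
  exact WithTop.coe_le_coe.mpr (le_top : (2 : ℕ∞) ≤ ⊤)

/-- Naturality of the exterior derivative under maps from a vector space to a manifold. -/
theorem Form.IsSmooth.extDeriv_flatPullback {σ : Form I M k} (hσ : σ.IsSmooth) {K : V → M} {v : V}
    (hK : ContMDiffAt 𝓘(ℝ, V) I ∞ K v) :
    extDeriv (σ.flatPullback K) v = σ.d.flatPullback K v := by
  have hp := mem_extChartAt_source (I := I) (K v)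
  have h2 := contDiffAt_extChartAt_comp hK hp
  rw [(σ.flatPullback_eventuallyEq hK hp).extDeriv_eq]
  -- The vector-space naturality applies in the chart at `K v`, which is the chart defining `σ.d` at
  -- that point. The chain rule then matches the two linear maps.
  have h3 := extDeriv_pullback (f := extChartAt I (K v) ∘ K)
    ((hσ.contDiffAt_inChart (mem_extChartAt_target (I := I) (K v))).differentiableAt (by simp)) h2
    minSmoothness_two_le_infty
  refine h3.trans ?_
  have h4 := mfderiv_comp v (mdifferentiableAt_extChartAt (I := I) (mem_chart_source H (K v)))
    (hK.mdifferentiableAt (by simp))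
  rw [mfderiv_eq_fderiv] at h4
  ext w
  exact congrArg (fun A : V →L[ℝ] E => extDeriv (σ.inChart (K v)) (extChartAt I (K v) (K v))
    (fun i => A (w i))) h4

omit [I.Boundaryless] [IsManifold I ∞ M] in
theorem Form.inChart_eq_flatPullback (σ : Form I M k) (p : M) :
    σ.inChart p = σ.flatPullback (extChartAt I p).symm := rfl

/-- Chart independence of `d`: by definition `σ.d` uses a different chart at each point, and
naturality along the inverse of the chart at `p` shows that this single chart computes it throughout
its target. -/
theorem Form.IsSmooth.d_inChart {σ : Form I M k} (hσ : σ.IsSmooth) {p : M} {y : E}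
    (hy : y ∈ (extChartAt I p).target) : σ.d.inChart p y = extDeriv (σ.inChart p) y :=
  (hσ.extDeriv_flatPullback (contMDiffAt_extChartAt_symm hy)).symm

theorem Form.IsSmooth.isSmooth_d {σ : Form I M k} (hσ : σ.IsSmooth) : σ.d.IsSmooth := by
  intro p
  have h1 : ContDiffOn ℝ ∞ (fderiv ℝ (σ.inChart p)) (extChartAt I p).target :=
    (hσ p).fderiv_of_isOpen (isOpen_extChartAt_target p) (by simp)
  have h2 : ContDiffOn ℝ ∞ (ContinuousAlternatingMap.alternatizeUncurryFinCLM ℝ E ℝ (n := k) ∘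
      fderiv ℝ (σ.inChart p)) (extChartAt I p).target :=
    (ContinuousLinearMap.contDiff _).comp_contDiffOn h1
  exact h2.congr fun y hy => hσ.d_inChart hy

theorem Form.IsSmooth.d_d {σ : Form I M k} (hσ : σ.IsSmooth) : σ.d.d = 0 := by
  funext p
  have hy := mem_extChartAt_target (I := I) p
  have h1 : σ.d.inChart p =ᶠ[𝓝 (extChartAt I p p)] extDeriv (σ.inChart p) :=
    (eventually_of_mem (extChartAt_target_mem_nhds_of_boundaryless hy) fun y hy => hσ.d_inChart hy)
  have h2 : extDeriv (σ.d.inChart p) (extChartAt I p p) = 0 := by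
    rw [h1.extDeriv_eq]
    exact extDeriv_extDeriv_apply (hσ.contDiffAt_inChart hy)
      minSmoothness_two_le_infty
  ext w
  exact congrArg (fun A : E [⋀^Fin (k + 2)]→L[ℝ] ℝ => A fun i => mfderiv I 𝓘(ℝ, E) (extChartAt I p) p (w i)) h2

omit [IsManifold I ∞ M] in
theorem mfderiv_extChartAt_symm_apply [IsManifold I 1 M] (p : M) (w : TangentSpace I p) :
    (mfderiv 𝓘(ℝ, E) I (extChartAt I p).symm (extChartAt I p p) : E →L[ℝ] E)
      ((mfderiv I 𝓘(ℝ, E) (extChartAt I p) p : E →L[ℝ] E) w) = w := by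
  have h := mfderivWithin_extChartAt_symm_comp_mfderiv_extChartAt' (I := I) (mem_extChartAt_source p)
  rw [ModelWithCorners.range_eq_univ, mfderivWithin_univ] at h
  exact congrArg (fun A : E →L[ℝ] E => A w) h

omit [IsManifold I ∞ M] in
theorem Form.apply_eq_inChart [IsManifold I 1 M] (σ : Form I M k) (p : M)
    (w : Fin k → TangentSpace I p) :
    σ p w = σ.inChart p (extChartAt I p p)
      (fun i => (mfderiv I 𝓘(ℝ, E) (extChartAt I p) p : E →L[ℝ] E) (w i)) := by
  have gen : ∀ (q : M) (u : Fin k → E), q = p → u = w → σ p w = σ q u := by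
    rintro q u rfl rfl
    rfl
  exact gen _ _ (extChartAt_to_inv p) (funext fun i => mfderiv_extChartAt_symm_apply p (w i))

variable {E' : Type*} [NormedAddCommGroup E'] [NormedSpace ℝ E']
    {H' : Type*} [TopologicalSpace H'] {I' : ModelWithCorners ℝ E' H'} [I'.Boundaryless]
    {N : Type*} [TopologicalSpace N] [ChartedSpace H' N] [IsManifold I' ∞ N]

omit [I.Boundaryless] [IsManifold I ∞ M] [I'.Boundaryless] [IsManifold I' ∞ N] in
theorem Form.flatPullback_pullback (σ : Form I M k) {f : N → M} {K : V → N} {v : V}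
    (hf : MDifferentiableAt I' I f (K v)) (hK : MDifferentiableAt 𝓘(ℝ, V) I' K v) :
    (σ.pullback f : Form I' N k).flatPullback K v = σ.flatPullback (f ∘ K) v := by
  have h := mfderiv_comp v hf hK
  ext w
  exact (congrArg (fun A : V →L[ℝ] E => σ (f (K v)) (fun i => A (w i))) h).symm

/-- The exterior derivative commutes with pull-backs. -/
theorem Form.IsSmooth.d_pullback {σ : Form I M k} (hσ : σ.IsSmooth) {f : N → M}
    (hf : ContMDiff I' I ∞ f) :
    (σ.pullback f : Form I' N k).d = (σ.d.pullback f : Form I' N (k + 1)) := by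
  funext p
  have hy := mem_extChartAt_target (I := I') p
  have hK := contMDiffAt_extChartAt_symm hy
  have hf' := hf.mdifferentiable (by simp)
  have h1 : (σ.pullback f : Form I' N k).inChart p =ᶠ[𝓝 (extChartAt I' p p)]
      σ.flatPullback (f ∘ (extChartAt I' p).symm) :=
    eventually_of_mem (extChartAt_target_mem_nhds_of_boundaryless hy) fun y hy =>
      σ.flatPullback_pullback (hf' _) (mdifferentiableAt_extChartAt_symm hy)
  have h2 : extDeriv ((σ.pullback f : Form I' N k).inChart p) (extChartAt I' p p) =
      (σ.d.pullback f : Form I' N (k + 1)).inChart p (extChartAt I' p p) := by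
    rw [h1.extDeriv_eq, hσ.extDeriv_flatPullback (hf.contMDiffAt.comp _ hK)]
    exact (σ.d.flatPullback_pullback (hf' _) (mdifferentiableAt_extChartAt_symm hy)).symm
  ext w
  rw [Form.apply_eq_inChart (σ.d.pullback f), ← h2]
  rfl

end ExteriorDerivative

/-! ### Alternating forms and exterior derivatives on vector spaces. -/

section FlatForms

variable {V W : Type*} [NormedAddCommGroup V] [NormedSpace ℝ V]
  [NormedAddCommGroup W] [NormedSpace ℝ W]

theorem extDeriv_apply_two {η : V → V [⋀^Fin 1]→L[ℝ] ℝ} {z : V} (hη : DifferentiableAt ℝ η z)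
    (u w : V) : extDeriv η z ![u, w] =
      fderiv ℝ (fun x => η x ![w]) z u - fderiv ℝ (fun x => η x ![u]) z w := by
  rw [extDeriv_apply hη, Fin.sum_univ_two]
  have h0 : (0 : Fin 2).removeNth ![u, w] = ![w] := by
    ext i; fin_cases i; rfl
  have h1 : (1 : Fin 2).removeNth ![u, w] = ![u] := by
    ext i; fin_cases i; rfl
  rw [h0, h1]
  simp [sub_eq_add_neg]

theorem differentiableAt_alternating_apply {k : ℕ} {η : V → W [⋀^Fin k]→L[ℝ] ℝ} {z : V}
    (hη : DifferentiableAt ℝ η z) (u : Fin k → W) : DifferentiableAt ℝ (fun x => η x u) z :=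
  (ContinuousAlternatingMap.apply ℝ W ℝ u).differentiableAt.comp z hη

theorem alternating_two_swap (A : V [⋀^Fin 2]→L[ℝ] ℝ) (u w : V) : A ![u, w] = - A ![w, u] := by
  have h2 := A.toAlternatingMap.map_swap ![w, u] (i := 0) (j := 1) (by decide)
  have h3 : (![w, u] ∘ Equiv.swap (0 : Fin 2) 1) = ![u, w] := by
    ext i; fin_cases i <;> rfl
  rw [h3] at h2
  exact h2

/-- Testing `u = (a, b)` against `(0, a)` gives `G a a = 0`, so `a = 0`. Then `u` is itself
vertical, and testing it against `(b, 0)` gives `G b b = 0`. -/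
theorem eq_zero_of_vertical_pairing (A : (V × V) [⋀^Fin 2]→L[ℝ] ℝ) (G : V →L[ℝ] V →L[ℝ] ℝ)
    (hG : ∀ v, v ≠ 0 → 0 < G v v) (hA : ∀ u c, A ![u, (0, c)] = - G c u.1) (u : V × V)
    (hu : ∀ w, A ![u, w] = 0) : u = 0 := by
  obtain ⟨a, b⟩ := u
  have ha : a = 0 := by
    by_contra ha
    have := hu (0, a)
    rw [hA] at this
    exact (hG a ha).ne' (neg_eq_zero.mp this)
  subst ha
  have hb : b = 0 := by
    by_contra hb
    have h2 := alternating_two_swap A (0, b) (b, 0)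
    rw [hu, hA, neg_neg] at h2
    exact (hG b hb).ne h2
  rw [hb]
  rfl

end FlatForms

/-! ### Charts of the tangent bundle and forms pulled back from the base. -/

section TangentChart

variable {E : Type*} [NormedAddCommGroup E] [NormedSpace ℝ E]
  {H : Type*} [TopologicalSpace H] {I : ModelWithCorners ℝ E H} [I.Boundaryless]
  {M : Type*} [TopologicalSpace M] [ChartedSpace H M] [IsManifold I ∞ M] {k : ℕ}

omit [I.Boundaryless] [IsManifold I ∞ M] in
theorem extChartAt_tangent_target [IsManifold I 1 M] (p : TangentBundle I M) :
    (extChartAt I.tangent p).target = (extChartAt I p.1).target ×ˢ Set.univ := by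
  rw [FiberBundle.extChartAt_target]
  congr 1
  ext y
  simp only [Set.mem_inter_iff, Set.mem_preimage, TangentBundle.trivializationAt_baseSet,
    and_iff_left_iff_imp]
  intro hy
  have := (extChartAt I p.1).map_target hy
  rwa [extChartAt_source] at this

omit [IsManifold I ∞ M] in
-- The trivialization behind the tangent chart is the differential of the base chart, so its inverse
-- is the differential of the inverse chart. This makes forms on the tangent bundle computable in
-- the coordinates `(x, v)`.
theorem extChartAt_tangent_symm [IsManifold I 1 M] (p : TangentBundle I M) {x : E} (v : E)
    (hx : x ∈ (extChartAt I p.1).target) :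
    (extChartAt I.tangent p).symm (x, v) =
      ⟨(extChartAt I p.1).symm x,
        (mfderiv 𝓘(ℝ, E) I (extChartAt I p.1).symm x : E →L[ℝ] E) v⟩ := by
  have hs : (extChartAt I p.1).symm x ∈ (chartAt H p.1).source := by
    have := (extChartAt I p.1).map_target hx
    rwa [extChartAt_source] at this
  have h1 := (trivializationAt E (TangentSpace I) p.1).mk_symm
    (b := (extChartAt I p.1).symm x) (by simpa using hs) v
  have h2 := TangentBundle.symmL_trivializationAt (I := I) hs
  rw [ModelWithCorners.range_eq_univ, mfderivWithin_univ, (extChartAt I p.1).right_inv hx] at h2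
  have h3 := (trivializationAt E (TangentSpace I) p.1).symmL_apply (R := ℝ)
    (b := (extChartAt I p.1).symm x) (by simpa using hs) v
  rw [FiberBundle.extChartAt]
  refine Eq.trans (b := (trivializationAt E (TangentSpace I) p.1).toOpenPartialHomeomorph.symm
    ((extChartAt I p.1).symm x, v)) rfl ?_
  rw [← h1, ← h3]
  exact congrArg (fun A : E →L[ℝ] E => (⟨(extChartAt I p.1).symm x, A v⟩ : TangentBundle I M)) h2

omit [IsManifold I ∞ M] in
theorem proj_extChartAt_tangent_symm [IsManifold I 1 M] (p : TangentBundle I M) {y : E × E}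
    (hy : y ∈ (extChartAt I.tangent p).target) :
    (Bundle.TotalSpace.proj ∘ (extChartAt I.tangent p).symm : E × E → M) =ᶠ[𝓝 y]
      (extChartAt I p.1).symm ∘ Prod.fst := by
  filter_upwards [extChartAt_target_mem_nhds_of_boundaryless hy] with z hz
  rw [extChartAt_tangent_target] at hz
  exact congrArg Bundle.TotalSpace.proj (extChartAt_tangent_symm p z.2 hz.1)

omit [I.Boundaryless] in
theorem contMDiff_tangent_proj : ContMDiff I.tangent I ∞
    (Bundle.TotalSpace.proj : TangentBundle I M → M) := Bundle.contMDiff_proj _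

/-- Forms pulled back from the base, in a chart of the tangent bundle. -/
theorem Form.inChart_pullback_proj (σ : Form I M k) (p : TangentBundle I M) {y : E × E}
    (hy : y ∈ (extChartAt I.tangent p).target) :
    (σ.pullback Bundle.TotalSpace.proj : Form I.tangent (TangentBundle I M) k).inChart p y =
      (σ.inChart p.1 y.1).compContinuousLinearMap (ContinuousLinearMap.fst ℝ E E) := by
  have hy' := hy
  rw [extChartAt_tangent_target] at hy'
  rw [inChart_eq_flatPullback, σ.flatPullback_pullback
    (contMDiff_tangent_proj.mdifferentiable (by simp) _)
    (mdifferentiableAt_extChartAt_symm hy), σ.flatPullback_congr (proj_extChartAt_tangent_symm p hy),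
    σ.flatPullback_comp (mdifferentiableAt_extChartAt_symm hy'.1) differentiableAt_fst, fderiv_fst]
  rfl

theorem Form.IsSmooth.pullback_proj {σ : Form I M k} (hσ : σ.IsSmooth) :
    (σ.pullback Bundle.TotalSpace.proj : Form I.tangent (TangentBundle I M) k).IsSmooth := by
  intro p
  have h1 : ContDiffOn ℝ ∞ (fun y : E × E => σ.inChart p.1 y.1) (extChartAt I.tangent p).target := by
    refine (hσ p.1).comp contDiff_fst.contDiffOn fun y hy => ?_
    rw [extChartAt_tangent_target] at hy
    exact hy.1
  have h2 : ContDiffOn ℝ ∞ ((ContinuousAlternatingMap.compContinuousLinearMapCLM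
      (ContinuousLinearMap.fst ℝ E E) : (E [⋀^Fin k]→L[ℝ] ℝ) →L[ℝ] _) ∘
      fun y : E × E => σ.inChart p.1 y.1) (extChartAt I.tangent p).target :=
    (ContinuousLinearMap.contDiff _).comp_contDiffOn h1
  exact h2.congr fun y hy => σ.inChart_pullback_proj p hy

omit [I.Boundaryless] [IsManifold I ∞ M] in
theorem Form.inChart_sub (σ τ : Form I M k) (p : M) :
    (σ - τ).inChart p = σ.inChart p - τ.inChart p := rfl

omit [I.Boundaryless] [IsManifold I ∞ M] in
theorem Form.IsSmooth.sub {σ τ : Form I M k} (hσ : σ.IsSmooth) (hτ : τ.IsSmooth) :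
    (σ - τ).IsSmooth := fun p => (hσ p).sub (hτ p)

omit [IsManifold I ∞ M] in
theorem Form.IsSmooth.d_sub {σ τ : Form I M k} (hσ : σ.IsSmooth) (hτ : τ.IsSmooth) :
    (σ - τ).d = σ.d - τ.d := by
  funext p
  have hy := mem_extChartAt_target (I := I) p
  have h : extDeriv ((σ - τ).inChart p) (extChartAt I p p) =
      extDeriv (σ.inChart p) (extChartAt I p p) - extDeriv (τ.inChart p) (extChartAt I p p) := by
    rw [Form.inChart_sub, sub_eq_add_neg, ← neg_one_smul ℝ (τ.inChart p),
      extDeriv_add ((hσ.contDiffAt_inChart hy).differentiableAt (by simp))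
        (((hτ.contDiffAt_inChart hy).differentiableAt (by simp)).const_smul _),
      extDeriv_smul, neg_one_smul, sub_eq_add_neg]
  ext w
  exact congrArg (fun A : E [⋀^Fin (k + 1)]→L[ℝ] ℝ =>
    A fun i => mfderiv I 𝓘(ℝ, E) (extChartAt I p) p (w i)) h

omit [I.Boundaryless] [IsManifold I ∞ M] in
-- The preferred chart at `p` has the identity as its derivative at `p`, so the change of frame in
-- the definition of `d` disappears at the centre.
theorem Form.d_eq_extDeriv [IsManifold I 1 M] (σ : Form I M k) (p : M) :
    (σ.d p : E [⋀^Fin (k + 1)]→L[ℝ] ℝ) = extDeriv (σ.inChart p) (extChartAt I p p) := by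
  have h := mfderiv_extChartAt_self (I := I) (x := p)
  ext w
  exact congrArg (fun A : E →L[ℝ] E => extDeriv (σ.inChart p) (extChartAt I p p)
    fun i => A (w i)) h

omit [IsManifold I ∞ M] in
theorem Form.apply_eq_inChart' [IsManifold I 1 M] (σ : Form I M k) (p : M) :
    (σ p : E [⋀^Fin k]→L[ℝ] ℝ) = σ.inChart p (extChartAt I p p) := by
  have h := mfderiv_extChartAt_self (I := I) (x := p)
  ext w
  exact (σ.apply_eq_inChart p w).trans (congrArg (fun A : E →L[ℝ] E =>
    σ.inChart p (extChartAt I p p) fun i => A (w i)) h)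

end TangentChart

/-! ### The canonical one-form, the primitive of the twisted form, and nondegeneracy. -/

section Liouville

variable {E : Type*} [NormedAddCommGroup E] [NormedSpace ℝ E]
  {H : Type*} [TopologicalSpace H] {I : ModelWithCorners ℝ E H} [I.Boundaryless]
  {M : Type*} [TopologicalSpace M] [ChartedSpace H M] [IsManifold I ∞ M] {k : ℕ}

omit [I.Boundaryless] in
theorem Metric.contMDiffAt_inner (g : Metric I M) {E' : Type*} [NormedAddCommGroup E']
    [NormedSpace ℝ E'] {H' : Type*} [TopologicalSpace H'] {I' : ModelWithCorners ℝ E' H'}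
    {N : Type*} [TopologicalSpace N] [ChartedSpace H' N] {b : N → M}
    {v w : ∀ x, TangentSpace I (b x)} {x : N}
    (hv : ContMDiffAt I' I.tangent ∞ (fun x => (⟨b x, v x⟩ : TangentBundle I M)) x)
    (hw : ContMDiffAt I' I.tangent ∞ (fun x => (⟨b x, w x⟩ : TangentBundle I M)) x) :
    ContMDiffAt I' 𝓘(ℝ, ℝ) ∞ (fun x => g.inner (b x) (v x) (w x)) x := by
  have hb : ContMDiffAt I' I ∞ b x := (contMDiff_tangent_proj (I := I) _).comp x hv
  have : ContMDiffAt I' (I.prod 𝓘(ℝ, ℝ)) ∞ (fun m ↦ Bundle.TotalSpace.mk' ℝ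
      (E := Bundle.Trivial M ℝ) (b m) (g.inner (b m) (v m) (w m))) x := by
    apply ContMDiffAt.clm_bundle_apply₂ (F₁ := E) (F₂ := E)
    · exact (g.contMDiff _).comp x hb
    · exact hv
    · exact hw
  rw [Bundle.contMDiffAt_totalSpace] at this
  exact this.2

/-- The metric as a family of bilinear forms on the model space. -/
def Metric.flat (g : Metric I M) (q : M) : E →L[ℝ] E →L[ℝ] ℝ := g.inner q

/-- The differential of the inverse of the preferred chart at `q`. -/
def chartFrame (q : M) (x : E) : E →L[ℝ] E := mfderiv 𝓘(ℝ, E) I (extChartAt I q).symm x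

/-- The metric in the preferred chart at `q`. -/
def Metric.inChart (g : Metric I M) (q : M) (x : E) : E →L[ℝ] E →L[ℝ] ℝ :=
  (g.flat ((extChartAt I q).symm x)).bilinearComp (chartFrame (I := I) q x)
    (chartFrame (I := I) q x)

/-- In finite dimension it suffices to test on fixed vectors `u` and `w`. The coordinate field of
`u` is smooth, being the inverse tangent chart restricted to the slice with constant second
component `u`. -/
theorem Metric.contDiffOn_inChart [FiniteDimensional ℝ E] (g : Metric I M) (q : M) :
    ContDiffOn ℝ ∞ (g.inChart q) (extChartAt I q).target := by
  have hc : ∀ u : E, ∀ x ∈ (extChartAt I q).target, ContMDiffAt 𝓘(ℝ, E) I.tangent ∞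
      (fun x => (⟨(extChartAt I q).symm x,
        (mfderiv 𝓘(ℝ, E) I (extChartAt I q).symm x : E →L[ℝ] E) u⟩ : TangentBundle I M)) x := by
    intro u x hx
    have hx' : (x, u) ∈ (extChartAt I.tangent (⟨q, 0⟩ : TangentBundle I M)).target := by
      rw [extChartAt_tangent_target]
      exact ⟨hx, trivial⟩
    have h1 : ContMDiffAt 𝓘(ℝ, E) 𝓘(ℝ, E × E) ∞ (fun x : E => (x, u)) x :=
      (contDiff_prodMk_left u).contMDiff.contMDiffAt
    refine ((contMDiffAt_extChartAt_symm hx').comp x h1).congr_of_eventuallyEq ?_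
    filter_upwards [extChartAt_target_mem_nhds_of_boundaryless hx] with z hz
    exact (extChartAt_tangent_symm (⟨q, 0⟩ : TangentBundle I M) u hz).symm
  rw [contDiffOn_clm_apply]
  intro u
  rw [contDiffOn_clm_apply]
  intro w x hx
  exact (g.contMDiffAt_inner (hc u x hx) (hc w x hx)).contDiffAt.contDiffWithinAt

/-- In tangent coordinates `dπ` is the first projection followed by the chart frame, and the base
vector is the frame applied to `v`. This is the classical `∑ g_ij vⁱ dxʲ`. -/
theorem liouville_inChart (g : Metric I M) (p : TangentBundle I M) {y : E × E}
    (hy : y ∈ (extChartAt I.tangent p).target) :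
    (liouville g).inChart p y = ContinuousAlternatingMap.ofSubsingleton ℝ (E × E) ℝ (0 : Fin 1)
      ((g.inChart p.1 y.1 y.2).comp (ContinuousLinearMap.fst ℝ E E)) := by
  have hy' := hy
  rw [extChartAt_tangent_target] at hy'
  have h1 := mfderiv_comp y
    ((contMDiff_tangent_proj (I := I) (M := M)).mdifferentiable (by simp) _)
    (mdifferentiableAt_extChartAt_symm hy)
  have h2 := (proj_extChartAt_tangent_symm p hy).mfderiv_eq (I := 𝓘(ℝ, E × E)) (I' := I)
  have h3 := mfderiv_comp y (f := (Prod.fst : E × E → E)) (I := 𝓘(ℝ, E × E)) (I' := 𝓘(ℝ, E))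
    (mdifferentiableAt_extChartAt_symm hy'.1) differentiableAt_fst.mdifferentiableAt
  rw [mfderiv_eq_fderiv, fderiv_fst] at h3
  ext w
  have gen : ∀ (q q' : M) (u u' w w' : E), (⟨q, u⟩ : TangentBundle I M) = ⟨q', u'⟩ → w = w' →
      g.inner q u w = g.inner q' u' w' := by
    rintro q q' u u' w w' h rfl
    cases h
    rfl
  exact gen _ _ _ _ _ _ (extChartAt_tangent_symm p y.2 hy'.1)
    (congrArg (fun A : E × E →L[ℝ] E => A (w 0)) (h1.symm.trans (h2.trans h3)))

theorem isSmooth_liouville [FiniteDimensional ℝ E] (g : Metric I M) : (liouville g).IsSmooth := by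
  intro p
  have h1 : ContDiffOn ℝ ∞ (fun y : E × E => g.inChart p.1 y.1) (extChartAt I.tangent p).target := by
    refine (g.contDiffOn_inChart p.1).comp contDiff_fst.contDiffOn fun y hy => ?_
    rw [extChartAt_tangent_target] at hy
    exact hy.1
  have h2 := (h1.clm_apply contDiff_snd.contDiffOn).clm_comp
    (contDiffOn_const (c := ContinuousLinearMap.fst ℝ E E))
  have h3 := (ContinuousAlternatingMap.ofSubsingletonLIE (𝕜 := ℝ) (E := E × E)
    (F := ℝ) (0 : Fin 1)).toContinuousLinearEquiv.contDiff.comp_contDiffOn h2 (n := ∞)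
  exact h3.congr fun y hy => liouville_inChart g p hy

/-- The primitive `λ - π^* α` of the twisted form. -/
def twistedPotential (g : Metric I M) (α : Form I M 1) : Form I.tangent (TangentBundle I M) 1 :=
  liouville g - α.pullback (Bundle.TotalSpace.proj : TangentBundle I M → M)

theorem isSmooth_twistedPotential [FiniteDimensional ℝ E] (g : Metric I M) {α : Form I M 1}
    (hα : α.IsSmooth) : (twistedPotential g α).IsSmooth :=
  (isSmooth_liouville g).sub hα.pullback_proj

theorem d_twistedPotential [FiniteDimensional ℝ E] (g : Metric I M) {α : Form I M 1}
    (hα : α.IsSmooth) : (twistedPotential g α).d = twistedForm g α := by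
  rw [twistedPotential, (isSmooth_liouville g).d_sub hα.pullback_proj,
    hα.d_pullback contMDiff_tangent_proj]
  rfl

theorem Metric.inChart_self_pos (g : Metric I M) (q : M) {v : E} (hv : v ≠ 0) :
    0 < g.inChart q (extChartAt I q q) v v := by
  have h : chartFrame (I := I) q (extChartAt I q q) v = v := by
    have h1 := mfderiv_extChartAt_symm_apply (I := I) q v
    have h2 : (mfderiv I 𝓘(ℝ, E) (extChartAt I q) q : E →L[ℝ] E) v = v :=
      congrArg (fun A : E →L[ℝ] E => A v) (mfderiv_extChartAt_self (I := I) (x := q))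
    rwa [h2] at h1
  refine (g.pos ((extChartAt I q).symm (extChartAt I q q)) (v : E) hv).trans_eq ?_
  exact (congrArg (fun u : E => g.flat ((extChartAt I q).symm (extChartAt I q q)) u u) h).symm

/-- In the chart at `p`, the canonical two-form pairs vectors with vertical vectors through the
metric. -/
theorem d_liouville_vertical [FiniteDimensional ℝ E] (g : Metric I M) (p : TangentBundle I M)
    (u : E × E) (c : E) :
    ((liouville g).d p : (E × E) [⋀^Fin 2]→L[ℝ] ℝ) ![u, (0, c)] =
      - g.inChart p.1 (extChartAt I p.1 p.1) c u.1 := by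
  have hy := mem_extChartAt_target (I := I.tangent) p
  have hd : DifferentiableAt ℝ ((liouville g).inChart p) (extChartAt I.tangent p p) :=
    ((isSmooth_liouville g).contDiffAt_inChart hy).differentiableAt (by simp)
  have e : ∀ w : E × E, (fun x => (liouville g).inChart p x ![w]) =ᶠ[𝓝 (extChartAt I.tangent p p)]
      fun y => g.inChart p.1 y.1 y.2 w.1 := fun w => by
    filter_upwards [extChartAt_target_mem_nhds_of_boundaryless hy] with y hy
    rw [liouville_inChart g p hy]
    rfl
  have hx : (extChartAt I.tangent p p).1 = extChartAt I p.1 p.1 := by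
    rw [FiberBundle.extChartAt]
    rfl
  rw [Form.d_eq_extDeriv]
  refine (extDeriv_apply_two hd u (0, c)).trans ?_
  -- The canonical one-form vanishes on vertical vectors, so this term of the exterior derivative is
  -- zero.
  have h1 : fderiv ℝ (fun x => (liouville g).inChart p x ![((0 : E), c)])
      (extChartAt I.tangent p p) = 0 := by
    rw [(e _).fderiv_eq]
    simp
  -- Moving in the direction `(0, c)` keeps `x` fixed, and `g_x(v, u₁)` is linear in `v`, so its
  -- derivative is obtained by replacing `v` with `c`.
  have h2 : fderiv ℝ (fun x => (liouville g).inChart p x ![u]) (extChartAt I.tangent p p) (0, c) =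
      g.inChart p.1 (extChartAt I p.1 p.1) c u.1 := by
    have hdu : DifferentiableAt ℝ (fun y : E × E => g.inChart p.1 y.1 y.2 u.1)
        (extChartAt I.tangent p p) :=
      (e u).differentiableAt_iff.mp (differentiableAt_alternating_apply hd _)
    rw [(e u).fderiv_eq]
    rw [← hx]
    generalize extChartAt I.tangent p p = y at hdu ⊢
    obtain ⟨x, v⟩ := y
    have h3 : HasFDerivAt (fun v' : E => (x, v')) (ContinuousLinearMap.inr ℝ E E) v :=
      hasFDerivAt_prodMk_right x v
    have h4 := (HasFDerivAt.comp v hdu.hasFDerivAt h3).fderiv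
    have h5 : fderiv ℝ (fun v' : E => (g.inChart p.1 x).flip u.1 v') v =
      (g.inChart p.1 x).flip u.1 := ContinuousLinearMap.fderiv _
    exact (congrArg (fun A : E →L[ℝ] ℝ => A c) (h4.symm.trans h5))
  rw [h1, h2]
  simp

theorem pullback_proj_vertical (σ : Form I M 2) (p : TangentBundle I M)
    (u : E × E) (c : E) :
    ((σ.pullback Bundle.TotalSpace.proj : Form I.tangent (TangentBundle I M) 2) p :
      (E × E) [⋀^Fin 2]→L[ℝ] ℝ) ![u, (0, c)] = 0 := by
  have h := (Form.apply_eq_inChart' (σ.pullback Bundle.TotalSpace.proj :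
    Form I.tangent (TangentBundle I M) 2) p).trans
    (σ.inChart_pullback_proj p (mem_extChartAt_target (I := I.tangent) p))
  refine (congrArg (fun A : (E × E) [⋀^Fin 2]→L[ℝ] ℝ => A ![u, (0, c)]) h).trans ?_
  refine ContinuousAlternatingMap.map_coord_zero (σ.inChart p.1 (extChartAt I.tangent p p).1)
    (m := ![u.1, 0]) 1 rfl |>.symm.trans ?_ |>.symm
  refine congrArg (σ.inChart p.1 (extChartAt I.tangent p p).1) ?_
  ext i
  fin_cases i <;> rfl

/-- The magnetic term comes from the base and so kills vertical vectors; only the canonical two-form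
contributes. -/
theorem twistedForm_vertical [FiniteDimensional ℝ E] (g : Metric I M) (α : Form I M 1)
    (p : TangentBundle I M) (u : E × E) (c : E) :
    (twistedForm g α p : (E × E) [⋀^Fin 2]→L[ℝ] ℝ) ![u, (0, c)] =
      - g.inChart p.1 (extChartAt I p.1 p.1) c u.1 := by
  have h1 := d_liouville_vertical g p u c
  have h2 := pullback_proj_vertical α.d p u c
  exact (congrArg₂ (fun a b : ℝ => a - b) h1 h2).trans (sub_zero _)

theorem isSymplectic_twistedForm [FiniteDimensional ℝ E] (g : Metric I M) {α : Form I M 1}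
    (hα : α.IsSmooth) : (twistedForm g α).IsSymplectic where
  smooth := by
    rw [← d_twistedPotential g hα]
    exact (isSmooth_twistedPotential g hα).isSmooth_d
  closed := by
    rw [← d_twistedPotential g hα]
    exact (isSmooth_twistedPotential g hα).d_d
  nondegenerate p u hu :=
    eq_zero_of_vertical_pairing (twistedForm g α p : (E × E) [⋀^Fin 2]→L[ℝ] ℝ) _
      (fun _ hv => g.inChart_self_pos p.1 hv) (twistedForm_vertical g α p) u hu

end Liouville

/-! ### Cartan's formula for a one-form invariant under a smooth family of maps. -/

section Invariance

variable {V W : Type*} [NormedAddCommGroup V] [NormedSpace ℝ V]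
  [NormedAddCommGroup W] [NormedSpace ℝ W]

/-- For one-forms, pulling back by a linear map is composition with a linear functional under
`ofSubsingletonLIE`, and composition is smooth in both arguments jointly. -/
theorem contDiffAt_compContinuousLinearMap {U : Type*} [NormedAddCommGroup U] [NormedSpace ℝ U]
    {A : U → V [⋀^Fin 1]→L[ℝ] ℝ} {L : U → W →L[ℝ] V} {z : U} (hA : ContDiffAt ℝ ∞ A z)
    (hL : ContDiffAt ℝ ∞ L z) :
    ContDiffAt ℝ ∞ (fun x => (A x).compContinuousLinearMap (L x)) z := by
  have h1 : ContDiffAt ℝ ∞ (fun x => (ContinuousAlternatingMap.ofSubsingletonLIE (𝕜 := ℝ) (E := V)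
      (F := ℝ) (0 : Fin 1)).symm (A x)) z :=
    (LinearIsometryEquiv.contDiff _).contDiffAt.comp z hA
  have h2 := (ContinuousAlternatingMap.ofSubsingletonLIE (𝕜 := ℝ) (E := W)
      (F := ℝ) (0 : Fin 1)).contDiff.contDiffAt.comp z (h1.clm_comp hL)
  refine h2.congr_of_eventuallyEq (Eventually.of_forall fun x => ?_)
  ext w
  refine congrArg (A x) ?_
  ext i
  rw [Subsingleton.elim i 0]

variable {E : Type*} [NormedAddCommGroup E] [NormedSpace ℝ E]
  {H : Type*} [TopologicalSpace H] {I : ModelWithCorners ℝ E H} [I.Boundaryless]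
  {M : Type*} [TopologicalSpace M] [ChartedSpace H M] [IsManifold I ∞ M]

theorem Form.IsSmooth.contDiffAt_flatPullback {β : Form I M 1} (hβ : β.IsSmooth) {K : V → M}
    {v : V} (hK : ContMDiffAt 𝓘(ℝ, V) I ∞ K v) : ContDiffAt ℝ ∞ (β.flatPullback K) v := by
  have hp := mem_extChartAt_source (I := I) (K v)
  have h := contDiffAt_extChartAt_comp hK hp
  refine ContDiffAt.congr_of_eventuallyEq ?_ (β.flatPullback_eventuallyEq hK hp)
  have h1 : ContDiffAt ℝ ∞ (β.inChart (K v)) ((extChartAt I (K v) ∘ K) v) :=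
    hβ.contDiffAt_inChart ((extChartAt I (K v)).map_source hp)
  exact contDiffAt_compContinuousLinearMap (h1.comp v h) (h.fderiv_right (by simp))

theorem mfderiv_extChartAt_symm_self (p : M) :
    (mfderiv 𝓘(ℝ, E) I (extChartAt I p).symm (extChartAt I p p) : E →L[ℝ] E) =
      ContinuousLinearMap.id ℝ E := by
  ext w
  have h1 := mfderiv_extChartAt_symm_apply (I := I) p w
  have h2 : (mfderiv I 𝓘(ℝ, E) (extChartAt I p) p : E →L[ℝ] E) w = w :=
    congrArg (fun A : E →L[ℝ] E => A w) (mfderiv_extChartAt_self (I := I) (x := p))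
  rwa [h2] at h1

section Flow

variable {Φ : ℝ × M → M} (hΦ : ContMDiff (𝓘(ℝ, ℝ).prod I) I ∞ Φ)
include hΦ

theorem contMDiffAt_flow_chart {p : M} {t : ℝ} {y : E} (hy : y ∈ (extChartAt I p).target) :
    ContMDiffAt 𝓘(ℝ, ℝ × E) I ∞ (fun z : ℝ × E => Φ (z.1, (extChartAt I p).symm z.2)) (t, y) := by
  have h1 : ContMDiffAt 𝓘(ℝ, ℝ × E) 𝓘(ℝ, ℝ) ∞ (fun z : ℝ × E => z.1) (t, y) :=
    contDiff_fst.contMDiff.contMDiffAt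
  have h2 : ContMDiffAt 𝓘(ℝ, ℝ × E) 𝓘(ℝ, E) ∞ (fun z : ℝ × E => z.2) (t, y) :=
    contDiff_snd.contMDiff.contMDiffAt
  have h3 : ContMDiffAt 𝓘(ℝ, E) I ∞ (extChartAt I p).symm ((t, y) : ℝ × E).2 :=
    contMDiffAt_extChartAt_symm hy
  exact (hΦ _).comp (t, y) (h1.prodMk (h3.comp (t, y) h2))

theorem contMDiff_flow_left (t : ℝ) : ContMDiff I I ∞ (fun q => Φ (t, q)) :=
  hΦ.comp (contMDiff_const.prodMk contMDiff_id)

/-- Freezing `t` turns the map into `Φ(t, ·)` after the inverse chart, and `Φ(t, ·)` preserves `β`.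
The right-hand side is free of `t`, which plays the role of `L_ξ β = 0`. -/
theorem flatPullback_flow_inr {β : Form I M 1}
    (hβΦ : ∀ t, (β.pullback (fun q => Φ (t, q)) : Form I M 1) = β) {p : M} {t : ℝ} {y : E}
    (hy : y ∈ (extChartAt I p).target) (w : E) :
    β.flatPullback (fun z : ℝ × E => Φ (z.1, (extChartAt I p).symm z.2)) (t, y) ![((0 : ℝ), w)] =
      β.inChart p y ![w] := by
  have h1 : HasFDerivAt (fun y' : E => (t, y')) (ContinuousLinearMap.inr ℝ ℝ E) y :=
    hasFDerivAt_prodMk_right t y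
  have h2 := β.flatPullback_comp (K := fun z : ℝ × E => Φ (z.1, (extChartAt I p).symm z.2))
    ((contMDiffAt_flow_chart hΦ hy).mdifferentiableAt (by simp)) h1.differentiableAt
  have h3 := β.flatPullback_pullback (f := fun q => Φ (t, q)) (K := (extChartAt I p).symm) (v := y)
    ((contMDiff_flow_left hΦ t).mdifferentiable (by simp) _) (mdifferentiableAt_extChartAt_symm hy)
  rw [hβΦ t] at h3
  rw [Form.inChart_eq_flatPullback, h3]
  refine Eq.trans ?_ (congrArg (fun A : E [⋀^Fin 1]→L[ℝ] ℝ => A ![w]) h2).symm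
  rw [h1.fderiv]
  refine congrArg (β.flatPullback _ (t, y)) ?_
  ext i <;> fin_cases i <;> rfl

omit hΦ in
theorem flatPullback_curve (β : Form I M 1) {γ : ℝ → M} {q : M} {v : TangentSpace I q}
    (h : velocity I γ = ⟨q, v⟩) : β.flatPullback γ 0 ![(1 : ℝ)] = β q ![v] := by
  obtain ⟨h1, h2⟩ := velocity_eq_iff.mp h
  have gen : ∀ (q' : M) (u : Fin 1 → E), q' = q → u = ![v] → β q' u = β q ![v] := by
    rintro q' u rfl rfl
    rfl
  refine gen _ _ h1 ?_
  ext i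
  rw [Subsingleton.elim i 0]
  exact h2

/-- Freezing `y` leaves the curve `t ↦ Φ(t, q)`, whose velocity is prescribed at `t = 0` only. Thus
`β(ξ)` is the `∂_t` component of the pulled-back form on that slice. -/
theorem flatPullback_flow_inl {β : Form I M 1} {ξ : ∀ q : M, TangentSpace I q}
    (hξ : ∀ q, velocity I (fun t => Φ (t, q)) = ⟨q, ξ q⟩) {p : M} {y : E}
    (hy : y ∈ (extChartAt I p).target) :
    β.flatPullback (fun z : ℝ × E => Φ (z.1, (extChartAt I p).symm z.2)) (0, y) ![((1 : ℝ), 0)] =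
      β ((extChartAt I p).symm y) ![ξ ((extChartAt I p).symm y)] := by
  have h1 : HasFDerivAt (fun t' : ℝ => (t', y)) (ContinuousLinearMap.inl ℝ ℝ E) 0 :=
    hasFDerivAt_prodMk_left 0 y
  have h2 := β.flatPullback_comp (K := fun z : ℝ × E => Φ (z.1, (extChartAt I p).symm z.2))
    (f := fun t' : ℝ => (t', y)) (v := 0)
    ((contMDiffAt_flow_chart hΦ hy).mdifferentiableAt (by simp)) h1.differentiableAt
  refine Eq.trans ?_ (flatPullback_curve β (hξ ((extChartAt I p).symm y)))
  refine Eq.trans ?_ (congrArg (fun A : ℝ [⋀^Fin 1]→L[ℝ] ℝ => A ![1]) h2).symm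
  rw [h1.fderiv]
  refine congrArg (β.flatPullback _ (0, y)) ?_
  ext i <;> fin_cases i <;> rfl

/-- If a smooth one-form `β` is invariant under a smooth family `Φ` of maps that starts at the
identity with velocity `ξ`, then `β(ξ)` is smooth. -/
theorem contMDiff_flow_moment {β : Form I M 1} (hβ : β.IsSmooth) {ξ : ∀ q : M, TangentSpace I q}
    (hξ : ∀ q, velocity I (fun t => Φ (t, q)) = ⟨q, ξ q⟩) :
    ContMDiff I 𝓘(ℝ, ℝ) ∞ (fun q => β q ![ξ q]) := by
  intro p
  have hy := mem_extChartAt_target (I := I) p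
  -- Smoothness of `ξ` is not assumed: `β(ξ)` is smooth as a component of the pull-back of `β` along
  -- a smooth map.
  have h1 : ContDiffAt ℝ ∞ (fun y => β.flatPullback
      (fun z : ℝ × E => Φ (z.1, (extChartAt I p).symm z.2)) (0, y) ![((1 : ℝ), (0 : E))])
      (extChartAt I p p) := by
    have h2 := hβ.contDiffAt_flatPullback (contMDiffAt_flow_chart hΦ hy (t := 0))
    have h3 : ContDiffAt ℝ ∞ (fun y : E => ((0 : ℝ), y)) (extChartAt I p p) :=
      (contDiff_prodMk_right 0).contDiffAt
    exact (ContinuousAlternatingMap.apply ℝ (ℝ × E) ℝ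
      ![((1 : ℝ), (0 : E))]).contDiff.contDiffAt.comp _ (h2.comp _ h3)
  have h4 := h1.contMDiffAt.comp p (contMDiffAt_extChartAt (I := I) (n := ∞) (x := p))
  refine h4.congr_of_eventuallyEq ?_
  filter_upwards [(isOpen_extChartAt_source (I := I) p).mem_nhds (mem_extChartAt_source p)] with q hq
  have h5 := flatPullback_flow_inl hΦ (β := β) hξ ((extChartAt I p).map_source hq)
  rw [(extChartAt I p).left_inv hq] at h5
  exact h5.symm

/-- If a smooth one-form `β` is invariant under a smooth family `Φ` of maps that starts at the
identity with velocity `ξ`, then `ι_ξ dβ = - d(β(ξ))`. -/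
theorem d_flow_moment {β : Form I M 1} (hβ : β.IsSmooth)
    (hβΦ : ∀ t, (β.pullback (fun q => Φ (t, q)) : Form I M 1) = β) {ξ : ∀ q : M, TangentSpace I q}
    (hξ : ∀ q, velocity I (fun t => Φ (t, q)) = ⟨q, ξ q⟩) (p : M) (w : TangentSpace I p) :
    β.d p ![ξ p, w] = - (mfderiv I 𝓘(ℝ, ℝ) (fun q => β q ![ξ q]) p w : ℝ) := by
  have hy := mem_extChartAt_target (I := I) p
  let K : ℝ × E → M := fun z => Φ (z.1, (extChartAt I p).symm z.2)
  have hK : ContMDiffAt 𝓘(ℝ, ℝ × E) I ∞ K (0, extChartAt I p p) := contMDiffAt_flow_chart hΦ hy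
  have hη : DifferentiableAt ℝ (β.flatPullback K) (0, extChartAt I p p) :=
    (hβ.contDiffAt_flatPullback hK).differentiableAt (by simp)
  have h1 := extDeriv_apply_two hη ((1 : ℝ), 0) ((0 : ℝ), (w : E))
  have hinl : HasFDerivAt (fun t' : ℝ => (t', extChartAt I p p)) (ContinuousLinearMap.inl ℝ ℝ E) 0 :=
    hasFDerivAt_prodMk_left 0 _
  have hinr : HasFDerivAt (fun y' : E => ((0 : ℝ), y')) (ContinuousLinearMap.inr ℝ ℝ E)
      (extChartAt I p p) := hasFDerivAt_prodMk_right 0 _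
  -- By invariance the component along `w` is constant in `t`.
  have h2 : fderiv ℝ (fun x => β.flatPullback K x ![((0 : ℝ), (w : E))]) (0, extChartAt I p p)
      ((1 : ℝ), 0) = 0 := by
    have h3 := (HasFDerivAt.comp (0 : ℝ) (differentiableAt_alternating_apply hη
      ![((0 : ℝ), (w : E))]).hasFDerivAt hinl).fderiv
    have h4 : ((fun x => β.flatPullback K x ![((0 : ℝ), (w : E))]) ∘
        fun t' : ℝ => (t', extChartAt I p p)) = fun _ => β.inChart p (extChartAt I p p) ![(w : E)] :=
      funext fun t => flatPullback_flow_inr hΦ hβΦ hy w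
    rw [h4] at h3
    have h5 := congrArg (fun A : ℝ →L[ℝ] ℝ => A 1) h3
    simpa using h5.symm
  have h3 : fderiv ℝ (fun x => β.flatPullback K x ![((1 : ℝ), (0 : E))]) (0, extChartAt I p p)
      ((0 : ℝ), w) = (mfderiv I 𝓘(ℝ, ℝ) (fun q => β q ![ξ q]) p w : ℝ) := by
    have h3 := (HasFDerivAt.comp (extChartAt I p p) (differentiableAt_alternating_apply hη
      ![((1 : ℝ), (0 : E))]).hasFDerivAt hinr).fderiv
    have h4 : ((fun x => β.flatPullback K x ![((1 : ℝ), (0 : E))]) ∘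
        fun y' : E => ((0 : ℝ), y')) =ᶠ[𝓝 (extChartAt I p p)]
        (fun q => β q ![ξ q]) ∘ (extChartAt I p).symm := by
      filter_upwards [extChartAt_target_mem_nhds_of_boundaryless hy] with y hy
      exact flatPullback_flow_inl hΦ hξ hy
    rw [h4.fderiv_eq] at h3
    have h5 : (mfderiv I 𝓘(ℝ, ℝ) (fun q => β q ![ξ q]) p : E →L[ℝ] ℝ) =
        fderiv ℝ ((fun q => β q ![ξ q]) ∘ (extChartAt I p).symm) (extChartAt I p p) := by
      have h6 := ((contMDiff_flow_moment hΦ hβ hξ).mdifferentiable (by simp) p).mfderiv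
      rw [ModelWithCorners.range_eq_univ, fderivWithin_univ] at h6
      exact h6
    exact (congrArg (fun A : E →L[ℝ] ℝ => A w) (h5.trans h3)).symm
  have h4 : extDeriv (β.flatPullback K) (0, extChartAt I p p) ![((1 : ℝ), 0), ((0 : ℝ), (w : E))] =
      - (mfderiv I 𝓘(ℝ, ℝ) (fun q => β q ![ξ q]) p w : ℝ) := by
    rw [h1, h2, zero_sub]
    exact congrArg Neg.neg h3
  refine Eq.trans ?_ h4
  -- By naturality it remains to compute the differential of `K` at `t = 0`: it sends `∂_t` to `ξ p`
  -- and fixes `w`.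
  rw [hβ.extDeriv_flatPullback hK]
  have hK' := hK.mdifferentiableAt (by simp)
  have hs : (extChartAt I p).symm (extChartAt I p p) = p := extChartAt_to_inv p
  have e1 : (mfderiv 𝓘(ℝ, ℝ × E) I K (0, extChartAt I p p) : ℝ × E →L[ℝ] E) ((1 : ℝ), 0) = ξ p := by
    have h5 := mfderiv_comp (0 : ℝ) (I' := 𝓘(ℝ, ℝ × E)) hK' hinl.differentiableAt.mdifferentiableAt
    rw [mfderiv_eq_fderiv, hinl.fderiv] at h5
    have h6 : (K ∘ fun t' : ℝ => (t', extChartAt I p p)) = fun t => Φ (t, p) :=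
      funext fun t => congrArg (fun q => Φ (t, q)) hs
    rw [h6] at h5
    exact (congrArg (fun A : ℝ →L[ℝ] E => A 1) h5).symm.trans (velocity_eq_iff.mp (hξ p)).2
  have e2 : (mfderiv 𝓘(ℝ, ℝ × E) I K (0, extChartAt I p p) : ℝ × E →L[ℝ] E) ((0 : ℝ), w) = w := by
    have h5 := mfderiv_comp (extChartAt I p p) (I' := 𝓘(ℝ, ℝ × E)) hK'
      hinr.differentiableAt.mdifferentiableAt
    rw [mfderiv_eq_fderiv, hinr.fderiv] at h5
    -- The base points in `hξ` record that `Φ(0, ·)` is the identity, so `K(0, ·)` is the inverse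
    -- chart, whose derivative at the centre is the identity.
    have h6 : (K ∘ fun y' : E => ((0 : ℝ), y')) = (extChartAt I p).symm :=
      funext fun y => (velocity_eq_iff.mp (hξ _)).1
    rw [h6] at h5
    exact (congrArg (fun A : E →L[ℝ] E => A w) h5).symm.trans
      (congrArg (fun A : E →L[ℝ] E => A w) (mfderiv_extChartAt_symm_self p))
  have gen : ∀ (q : M) (u u' : Fin 2 → E), p = q → u = u' → β.d p u = β.d q u' := by
    rintro q u u' rfl rfl
    rfl
  refine gen _ _ _ ((congrArg (fun q => Φ (0, q)) hs).trans (velocity_eq_iff.mp (hξ p)).1).symm ?_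
  ext i
  fin_cases i
  · exact e1.symm
  · exact e2.symm

end Flow

end Invariance

/-! ### The lifted action on the tangent bundle and its moment map. -/

section LiftedAction

variable {E : Type*} [NormedAddCommGroup E] [NormedSpace ℝ E]
  {H : Type*} [TopologicalSpace H] {I : ModelWithCorners ℝ E H} [I.Boundaryless]
  {M : Type*} [TopologicalSpace M] [ChartedSpace H M] [IsManifold I ∞ M]

theorem contMDiff_smul (ψ : Diff I M) :
    ContMDiff I.tangent I.tangent ∞ (fun p : TangentBundle I M => ψ • p) :=
  ψ.contMDiff.contMDiff_tangentMap (by simp)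

theorem mfderiv_proj_smul (ψ : Diff I M) (p : TangentBundle I M) (w : E × E) :
    (mfderiv I.tangent I (Bundle.TotalSpace.proj : TangentBundle I M → M) (ψ • p) : E × E →L[ℝ] E)
      ((mfderiv I.tangent I.tangent (fun p : TangentBundle I M => ψ • p) p : E × E →L[ℝ] E × E) w) =
    (mfderiv I I ψ p.1 : E →L[ℝ] E)
      ((mfderiv I.tangent I (Bundle.TotalSpace.proj : TangentBundle I M → M) p : E × E →L[ℝ] E) w) := by
  have hπ := (contMDiff_tangent_proj (I := I) (M := M)).mdifferentiable (by simp)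
  have h1 := mfderiv_comp p (hπ (ψ • p)) ((contMDiff_smul ψ).mdifferentiable (by simp) p)
  have h2 := mfderiv_comp p (mdiffAt ψ p.1) (hπ p)
  have h3 : (Bundle.TotalSpace.proj : TangentBundle I M → M) ∘ (fun p : TangentBundle I M => ψ • p) =
    ψ ∘ (Bundle.TotalSpace.proj : TangentBundle I M → M) := rfl
  rw [h3] at h1
  exact congrArg (fun A : E × E →L[ℝ] E => A w) (h1.symm.trans h2)

/-- Since `dπ` intertwines the lifted differential with `dψ`, both terms reduce to the invariance of
`g` and of `α` at the base point. -/
theorem twistedPotential_pullback_smul (g : Metric I M) (α : Form I M 1) (ψ : magEx g α) :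
    ((twistedPotential g α).pullback (fun p : TangentBundle I M => ψ • p) :
      Form I.tangent (TangentBundle I M) 1) = twistedPotential g α := by
  funext p
  ext w
  have h1 := mfderiv_proj_smul (ψ : Diff I M) p (w 0)
  let π' : E × E →L[ℝ] E :=
    mfderiv I.tangent I (Bundle.TotalSpace.proj : TangentBundle I M → M) p
  have h2 := ψ.2.1 p.1 p.2 (π' (w 0))
  have h3 := congrArg (fun A : E [⋀^Fin 1]→L[ℝ] ℝ => A ![π' (w 0)]) (congrFun ψ.2.2 p.1)
  have gen : ∀ (q : M) (v : TangentSpace I q) (x x' : E) (y y' : Fin 1 → E), x = x' → y = y' →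
      (g.inner q v x - α q y : ℝ) = g.inner q v x' - α q y' := by
    rintro q v x x' y y' rfl rfl
    rfl
  refine Eq.trans (gen _ _ _ _ _ (fun i => (mfderiv I I (ψ : Diff I M) p.1 : E →L[ℝ] E)
    (![π' (w 0)] i)) h1 ?_) (congrArg₂ (fun a b : ℝ => a - b) h2 (h3.trans ?_))
  · ext i
    rw [Subsingleton.elim i 0]
    exact h1
  · refine congrArg (α p.1) ?_
    ext i
    rw [Subsingleton.elim i 0]
    rfl

/-- Joint smoothness in `t` and `p`: the lifted family is the tangent map of `(t, q) ↦ c_t q`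
restricted to vectors with zero `t`-component, hence a composition of smooth maps. -/
theorem contMDiff_lifted_curve {G : Subgroup (Diff I M)} {c : ℝ → G}
    {X : ∀ q : M, TangentSpace I q} (hc : IsCurveWithVelocity G c X) :
    ContMDiff (𝓘(ℝ, ℝ).prod I.tangent) I.tangent ∞
      (fun x : ℝ × TangentBundle I M => c x.1 • x.2) := by
  have h0 : ContMDiff 𝓘(ℝ, ℝ) 𝓘(ℝ, ℝ).tangent ∞
      (fun t : ℝ => (⟨t, (0 : ℝ)⟩ : TangentBundle 𝓘(ℝ, ℝ) ℝ)) :=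
    Bundle.contMDiff_zeroSection ℝ (TangentSpace 𝓘(ℝ, ℝ) : ℝ → Type)
  have h1 := (contMDiff_equivTangentBundleProd_symm (n := ∞) (I := 𝓘(ℝ, ℝ)) (M := ℝ) (I' := I)
    (M' := M)).comp ((h0.comp contMDiff_fst).prodMk
      (contMDiff_snd (M := ℝ) (I := 𝓘(ℝ, ℝ)) (N := TangentBundle I M) (J := I.tangent)))
  have h2 := (hc.smooth.contMDiff_tangentMap (m := ∞) (by simp)).comp h1
  convert! h2 using 1
  funext x
  have hF : MDifferentiableAt (𝓘(ℝ, ℝ).prod I) I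
      (fun x : ℝ × M => (c x.1 : Diff I M) x.2) (x.1, x.2.1) :=
    hc.smooth.mdifferentiableAt (by simp)
  have hr : MDifferentiableAt I (𝓘(ℝ, ℝ).prod I) (fun y : M => (x.1, y)) x.2.1 :=
    mdifferentiableAt_const.prodMk mdifferentiableAt_id
  have h3 := tangentMap_comp_at x.2 hF hr
  rw [tangentMap_prod_right] at h3
  exact h3

theorem contMDiff_lifted_curve_apply {G : Subgroup (Diff I M)} {c : ℝ → G}
    {X : ∀ q : M, TangentSpace I q} (hc : IsCurveWithVelocity G c X) (p : TangentBundle I M) :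
    ContMDiff 𝓘(ℝ, ℝ) I.tangent ∞ (fun t => c t • p) :=
  (contMDiff_lifted_curve hc).comp (contMDiff_id.prodMk contMDiff_const)

/-- The velocity of the lifted curve. -/
theorem exists_lifted_velocity {G : Subgroup (Diff I M)} {c : ℝ → G}
    {X : ∀ q : M, TangentSpace I q} (hc : IsCurveWithVelocity G c X) :
    ∃ ξ : ∀ p : TangentBundle I M, TangentSpace I.tangent p,
      ∀ p, velocity I.tangent (fun t => c t • p) = ⟨p, ξ p⟩ := by
  refine ⟨fun p => (mfderiv 𝓘(ℝ, ℝ) I.tangent (fun t => c t • p) 0 (1 : ℝ) : E × E), fun p => ?_⟩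
  refine velocity_eq_iff.mpr ⟨?_, rfl⟩
  rw [hc.zero, one_smul]

/-- The lifted curve `c_t • p` projects to the curve `c_t` applied to the base point, so `dπ ξ = X`.
Both terms of `β(ξ)` see `ξ` only through `dπ`. -/
theorem momentMap_eq_twistedPotential (g : Metric I M) (α : Form I M 1) {c : ℝ → magEx g α}
    {X : lieAlgebra (magEx g α)} (hc : IsCurveWithVelocity (magEx g α) c X.1)
    {ξ : ∀ p : TangentBundle I M, TangentSpace I.tangent p}
    (hξ : ∀ p, velocity I.tangent (fun t => c t • p) = ⟨p, ξ p⟩) (p : TangentBundle I M) :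
    momentMap g α p X = twistedPotential g α p ![ξ p] := by
  have hπ := (contMDiff_tangent_proj (I := I) (M := M)).mdifferentiable (by simp)
  have h1 := velocity_comp (I := I.tangent) (I' := I) (f := Bundle.TotalSpace.proj)
    (γ := fun t => c t • p) (hπ _) ((contMDiff_lifted_curve_apply hc p).mdifferentiable (by simp) 0)
  rw [hξ p] at h1
  have h2 := (hc.velocity_eq p.1).symm.trans h1
  have h3 : (X.1 p.1 : E) = (mfderiv I.tangent I
      (Bundle.TotalSpace.proj : TangentBundle I M → M) p : E × E →L[ℝ] E) (ξ p) :=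
    eq_of_heq ((Bundle.TotalSpace.mk.injEq _ _ _ _).mp h2).2
  have gen : ∀ (x x' : E) (y y' : Fin 1 → E), x = x' → y = y' →
      (g.inner p.1 p.2 x - α p.1 y : ℝ) = g.inner p.1 p.2 x' - α p.1 y' := by
    rintro x x' y y' rfl rfl
    rfl
  refine gen _ _ _ _ h3 ?_
  ext i
  rw [Subsingleton.elim i 0]
  exact h3

theorem momentMap_smul (g : Metric I M) (α : Form I M 1) (ψ : magEx g α) (p : TangentBundle I M)
    (X : lieAlgebra (magEx g α)) :
    momentMap g α (ψ • p) X = momentMap g α p (Ad (magEx g α) ψ⁻¹ X) := by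
  let A : E →L[ℝ] E := mfderiv I I (ψ : Diff I M) p.1
  let u : E := (Ad (magEx g α) ψ⁻¹ X).1 p.1
  have h1 : A u = X.1 ((ψ : Diff I M) p.1) := by
    have hinv : ((mfderiv I I (ψ : Diff I M) p.1 : E →L[ℝ] E)).IsInvertible :=
      ⟨(ψ : Diff I M).mfderivToContinuousLinearEquiv (by simp) p.1,
        (ψ : Diff I M).mfderivToContinuousLinearEquiv_coe (by simp)⟩
    -- `Ad` at `ψ⁻¹` is the pull-back by `(ψ⁻¹)⁻¹ = ψ`, that is, the inverse differential applied to
    -- the field at the image point.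
    have hu : u = A.inverse (X.1 ((ψ : Diff I M) p.1)) := by
      have h : (((ψ⁻¹)⁻¹ : magEx g α) : Diff I M) = ψ := by rw [inv_inv]
      exact congrArg (fun φ : Diff I M => (VectorField.mpullback I I φ X.1 p.1 : E)) h
    exact (hinv.inverse_apply_eq.mp hu.symm).symm
  have h2 := ψ.2.1 p.1 p.2 u
  have h3 := congrArg (fun B : E [⋀^Fin 1]→L[ℝ] ℝ => B ![u]) (congrFun ψ.2.2 p.1)
  have gen : ∀ (q : M) (v : TangentSpace I q) (x x' : E) (y y' : Fin 1 → E), x = x' → y = y' →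
      (g.inner q v x - α q y : ℝ) = g.inner q v x' - α q y' := by
    rintro q v x x' y y' rfl rfl
    rfl
  refine Eq.trans (gen _ _ _ _ _ (fun i => A (![u] i)) h1.symm ?_)
    (congrArg₂ (fun a b : ℝ => a - b) h2 h3)
  ext i
  rw [Subsingleton.elim i 0]
  exact h1.symm

theorem isHamiltonianAction_magEx [FiniteDimensional ℝ E] (g : Metric I M) {α : Form I M 1}
    (hα : α.IsSmooth) :
    IsHamiltonianAction (J := I.tangent) (magEx g α) (twistedForm g α) (momentMap g α) := by
  have hβ := isSmooth_twistedPotential g hα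
  have hω := d_twistedPotential g hα
  -- This is stated for an arbitrary curve representing `X`, so that it can be used for two curves
  -- at once when comparing their generators.
  have key : ∀ (X : lieAlgebra (magEx g α)) (c : ℝ → magEx g α)
      (ξ : ∀ p : TangentBundle I M, TangentSpace I.tangent p),
      IsCurveWithVelocity (magEx g α) c X.1 →
      (∀ p, velocity I.tangent (fun t => c t • p) = ⟨p, ξ p⟩) →
      ContMDiff I.tangent 𝓘(ℝ, ℝ) ∞ (fun p => momentMap g α p X) ∧
      ∀ (p : TangentBundle I M) (w : TangentSpace I.tangent p), twistedForm g α p ![ξ p, w] =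
        - (mfderiv I.tangent 𝓘(ℝ, ℝ) (fun p' => momentMap g α p' X) p w : ℝ) := by
    intro X c ξ hc hξ
    have hμ : (fun p => momentMap g α p X) = fun p => twistedPotential g α p ![ξ p] :=
      funext fun p => momentMap_eq_twistedPotential g α hc hξ p
    rw [hμ, ← hω]
    exact ⟨contMDiff_flow_moment (contMDiff_lifted_curve hc) hβ hξ,
      d_flow_moment (contMDiff_lifted_curve hc) hβ
        (fun t => twistedPotential_pullback_smul g α (c t)) hξ⟩
  have hsymp := isSymplectic_twistedForm g hα
  exact
  { symplectic := hsymp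
    smooth_smul := fun ψ => contMDiff_smul (ψ : Diff I M)
    preserves := fun ψ => by
      rw [← hω]
      exact (hβ.d_pullback (contMDiff_smul (ψ : Diff I M))).symm.trans
        (congrArg Form.d (twistedPotential_pullback_smul g α ψ))
    smooth_moment := fun X => by
      obtain ⟨c, hc⟩ := X.2
      obtain ⟨ξ, hξ⟩ := exists_lifted_velocity hc
      exact (key X c ξ hc hξ).1
    hamiltonian := fun X => by
      obtain ⟨c, hc⟩ := X.2
      obtain ⟨ξ, hξ⟩ := exists_lifted_velocity hc
      refine ⟨ξ, fun c' hc' p => ⟨(contMDiff_lifted_curve_apply hc' p).mdifferentiable (by simp) 0, ?_⟩,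
        (key X c ξ hc hξ).2⟩
      obtain ⟨ξ', hξ'⟩ := exists_lifted_velocity hc'
      rw [hξ' p]
      -- Both velocities contract with `ω` to `-d⟨μ, X⟩`, which does not involve the curve, so
      -- nondegeneracy forces them to agree.
      have h : (ξ' p - ξ p : E × E) = 0 := by
        refine hsymp.nondegenerate p (ξ' p - ξ p : E × E) fun w => ?_
        have h1 := (key X c' ξ' hc' hξ').2 p w
        rw [← (key X c ξ hc hξ).2 p w] at h1
        have h2 : ∀ (A : (E × E) [⋀^Fin 2]→L[ℝ] ℝ) (a b w : E × E), A ![a, w] = A ![b, w] →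
            A ![a - b, w] = 0 := fun A a b w h => by
          have h1 := A.toMultilinearMap.cons_add ![w] (a - b) b
          rw [sub_add_cancel] at h1
          exact add_eq_right.mp (h1.symm.trans h)
        exact h2 (twistedForm g α p) _ _ _ h1
      exact congrArg (fun v : E × E => (⟨p, v⟩ : TangentBundle I.tangent (TangentBundle I M)))
        (sub_eq_zero.mp h)
    equivariant := momentMap_smul g α }

end LiftedAction

end Magnetic

end

theorem mainTheorem3 {n : ℕ} {M : Type*} [TopologicalSpace M] [T2Space M] [CompactSpace M]
    [ChartedSpace (EuclideanSpace ℝ (Fin n)) M] [IsManifold (𝓡 n) ∞ M]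
    (g : Magnetic.Metric (𝓡 n) M) (α : Magnetic.Form (𝓡 n) M 1) (hα : α.IsSmooth) :
    Magnetic.IsHamiltonianAction (Magnetic.magEx g α)
      (Magnetic.twistedForm g α) (Magnetic.momentMap g α) :=
  Magnetic.isHamiltonianAction_magEx g hα
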